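/- For $r\in{]0,1[}$ put $\alpha=\frac{1+r}{2}$ and $$P_1=\begin{pmatrix}-r&r\alpha&0\\-\alpha&\alpha^2-r&r\alpha\\0&0&r^2\end{pmatrix},\quad P_2=\begin{pmatrix}r&-r\alpha&0\\\alpha&-2\alpha^2+r&\alpha\\0&-r\alpha&r\end{pmatrix},\quad P_3=\begin{pmatrix}r^2&0&0\\r\alpha&\alpha^2-r&-\alpha\\0&r\alpha&-r\end{pmatrix},\quad J=\begin{pmatrix}0&0&1\\0&1&0\\1&0&0\end{pmatrix}.$$ Consider four identical inelastic point particles on the line with restitution coefficient $r$; denote by $\mathfrak a,\mathfrak b,\mathfrak c$ the collisions of the pairs $1$-$2$, $2$-$3$, $3$-$4$. The $\mathfrak b$-to-$\mathfrak b$ mapping describes how the normal vector $u=(x,y,z)$ of the plane spanned by the relative positions and the relative velocities evolves from one collision $\mathfrak b$ to the next. It acts on $X=\{u\in\mathbb S^2: x\ge0,\ z\le0\}\cup\{u\in\mathbb S^2: x\le0,\ z\ge0\}$ as follows: replace $u$ by $-u$ if necessary so that $x\ge 0$, $z\le0$, and put $\widehat{\mathfrak P}_r(u)=P_iu/|P_iu|$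 with $i=1$ if $y>0$ and $\alpha y-x>0$ (collisions $\mathfrak{ab}$), $i=3$ if $y<0$ and $\alpha y-z<0$ (collisions $\mathfrak{cb}$), and $i=2$ otherwise (collisions $\mathfrak{acb}$ or $\mathfrak{cab}$). A point $u\in X$ generates the periodic orbit $132312$ if $\widehat{\mathfrak P}_r^{\,6}(u)=u$ and if $i$ takes successively the values $1,3,2,3,1,2$ at $u,\widehat{\mathfrak P}_r(u),\dots,\widehat{\mathfrak P}_r^{\,5}(u)$. **Theorem.** For every $r\in{]0,1[}$ the matrix $JP_2P_3P_1$ has a unique dominating eigenvalue, that is, a real simple eigenvalue whose modulus is strictly larger than that of all its other complex eigenvalues. Among the $r\in{]0,1[}$ for which it exists, let $u=u(r)$ be an associated eigenvector with $u_x=1$. The equation $\alpha u_y-u_x=0$ has exactly one root $r_{\mathrm{crit}}$ in $]0,1[$; it satisfies $|r_{\mathrm{crit}}-0.22006978614631047521|<10^{-20}$, and in particular $r_{\mathrm{crit}}>3-2\sqrt2$ and $r_{\mathrm{crit}}>0.1918$. For every $r\in{]r_{\mathrm{crit}},1[}$, the eigenvector $u$ with $u_x=1$ exists and is unique, and $u/|u|$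 is the single point of $X$ that generates the periodic orbit $132312$. The collisions of the particles along this orbit are those indicated by the pattern ($1=\mathfrak{ab}$, $3=\mathfrak{cb}$, $2=\mathfrak{acb}$ or $\mathfrak{cab}$). The orbit is locally stable: orbits of $\widehat{\mathfrak P}_r$ starting at points of $X$ close enough to $u/|u|$ remain arbitrarily close to the orbit of $u/|u|$ for all times and converge to it. -/

import Mathlib

open Set Filter Topology
open scoped Matrix

namespace FourSpheres

noncomputable section

/-- Vectors of `ℝ³`, with coordinates `u 0 = u_x`, `u 1 = u_y`, `u 2 = u_z`.
The Euclidean norm on them is `norm2` below (not the sup norm of the function type). -/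
abbrev Vec : Type := Fin 3 → ℝ

/-- The Euclidean norm of `ℝ³`. -/
def norm2 (u : Vec) : ℝ := √(u ⬝ᵥ u)

/-- The Euclidean normalization `u / |u|`. -/
def toSphere (u : Vec) : Vec := (norm2 u)⁻¹ • u

/-- `α = (1 + r) / 2`. -/
def alpha (r : ℝ) : ℝ := (r + 1) / 2

/-! ### The collision matrices and the piecewise linear mapping -/

def P1 (r : ℝ) : Matrix (Fin 3) (Fin 3) ℝ :=
  !![-r, r * alpha r, 0;
     -alpha r, alpha r ^ 2 - r, r * alpha r;
     0, 0, r ^ 2]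

def P2 (r : ℝ) : Matrix (Fin 3) (Fin 3) ℝ :=
  !![r, -(r * alpha r), 0;
     alpha r, -(2 * alpha r ^ 2) + r, alpha r;
     0, -(r * alpha r), r]

def P3 (r : ℝ) : Matrix (Fin 3) (Fin 3) ℝ :=
  !![r ^ 2, 0, 0;
     r * alpha r, alpha r ^ 2 - r, -alpha r;
     0, r * alpha r, -r]

def J : Matrix (Fin 3) (Fin 3) ℝ :=
  !![0, 0, 1;
     0, 1, 0;
     1, 0, 0]

/-- The three letters used to encode orbits. -/
inductive Block
  | one
  | two
  | three
  deriving DecidableEq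

def Block.matrix (r : ℝ) : Block → Matrix (Fin 3) (Fin 3) ℝ
  | .one => P1 r
  | .two => P2 r
  | .three => P3 r

/-- The domain `X` of the `b`-to-`b` mapping: unit vectors with `x ≥ 0, z ≤ 0` or
`x ≤ 0, z ≥ 0`. -/
def domX : Set Vec :=
  {u | u 0 ^ 2 + u 1 ^ 2 + u 2 ^ 2 = 1 ∧ ((0 ≤ u 0 ∧ u 2 ≤ 0) ∨ (u 0 ≤ 0 ∧ 0 ≤ u 2))}

/-- `u` and `-u` are normal to the same plane; choose the representative in the quadrant
`x ≥ 0, z ≤ 0`. -/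
def orient (u : Vec) : Vec := by
  classical exact if 0 ≤ u 0 ∧ u 2 ≤ 0 then u else -u

/-- The letter of a vector `u` of the quadrant `x ≥ 0, z ≤ 0`: which of the matrices
`P₁, P₂, P₃` the piecewise linear mapping applies at `u`. On the sets `αy = x` and `αy = z`
(triple collisions) and `y = 0` (where the collisions `a` and `c` are simultaneous), the matrix
is `P₂`. -/
def letter (r : ℝ) (u : Vec) : Block := by
  classical exact
    if 0 < u 1 ∧ 0 < alpha r * u 1 - u 0 then .one
    else if u 1 < 0 ∧ alpha r * u 1 - u 2 < 0 then .three
    else .two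

/-- The letter of a point of the domain `X`. -/
def code (r : ℝ) (u : Vec) : Block := letter r (orient u)

/-- The `b`-to-`b` mapping, as a normalized piecewise linear mapping of `X`; see
`bMap_eq_collisions` below for its description in terms of collisions. -/
def bMap (r : ℝ) (u : Vec) : Vec :=
  toSphere ((code r u).matrix r *ᵥ orient u)

/-! ### The collisions behind the `b`-to-`b` mapping -/

/-- The types of collisions: `a` (particles 1-2), `b` (particles 2-3), `c` (particles 3-4). -/
inductive Contact
  | a
  | b
  | c
  deriving DecidableEq

/-- The unit normal of the plane on which the given pair is in contact. -/
def Contact.axis : Contact → Vec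
  | .a => ![1, 0, 0]
  | .b => ![0, 1, 0]
  | .c => ![0, 0, 1]

/-- The action of a collision on the relative velocities. -/
def Contact.matrix (r : ℝ) : Contact → Matrix (Fin 3) (Fin 3) ℝ
  | .a => !![-r, 0, 0; alpha r, 1, 0; 0, 0, 1]
  | .b => !![1, alpha r, 0; 0, -r, 0; 0, alpha r, 1]
  | .c => !![1, 0, 0; 0, 1, alpha r; 0, 0, -r]

/-- The cyclic order `a → b → c → a`. -/
def Contact.succ : Contact → Contact
  | .a => .b
  | .b => .c
  | .c => .a

/-- The cyclic order reversed. -/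
def Contact.pred : Contact → Contact
  | .a => .c
  | .b => .a
  | .c => .b

/-- Relative velocities right after a collision of type `k`, in the plane normal to `u`:
`q = p ∧ u` with `p = u ∧ e_k`. -/
def velocity (k : Contact) (u : Vec) : Vec :=
  crossProduct (crossProduct u k.axis) u

/-- `q · v` with `v = u - (u · e_k) e_k`; its sign decides the next collision. -/
def discriminator (k : Contact) (u : Vec) : ℝ :=
  velocity k u ⬝ᵥ (u - (u ⬝ᵥ k.axis) • k.axis)

/-- The type of the collision that follows a collision of type `k` in the plane normal to `u`
(`none` if it is not determined). -/
def nextContact (k : Contact) (u : Vec) : Option Contact := by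
  classical exact
    if 0 < discriminator k u then some k.succ
    else if discriminator k u < 0 then some k.pred
    else none

/-- The normal vector `q' ∧ p'` after the next collision, of type `k'`, where `q' = K q` and
`p' = e_{k'} ∧ u`. -/
def afterCollision (r : ℝ) (k k' : Contact) (u : Vec) : Vec :=
  crossProduct (k'.matrix r *ᵥ velocity k u) (crossProduct k'.axis u)

/-- Follow the collisions, at most `n` of them, until the first collision of type `b`; returns the
word of the collisions and the final normal vector. -/
def runToB (r : ℝ) : ℕ → Contact → Vec → Option (List Contact × Vec)
  | 0, _, _ => none
  | n + 1, k, u =>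
    (nextContact k u).bind fun k' =>
      if k' = .b then some ([k'], afterCollision r k k' u)
      else (runToB r n k' (afterCollision r k k' u)).map fun p => (k' :: p.1, p.2)

/-- The collisions from one collision of type `b` to the next one, starting with the plane normal
to `u` (at most three collisions are needed). -/
def bToB (r : ℝ) (u : Vec) : Option (List Contact × Vec) := runToB r 3 .b (orient u)

/-- The collision words denoted by a letter: `1` is `ab`, `3` is `cb`, and `2` is, indistinctly,
`acb` or `cab`. -/
def Block.words : Block → Set (List Contact)
  | .one => {[.a, .b]}
  | .two => {[.a, .c, .b], [.c, .a, .b]}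
  | .three => {[.c, .b]}

/-! ### Consistency: away from the degenerate configurations, the `b`-to-`b` mapping is the result
of the collisions -/

theorem toSphere_smul {k : ℝ} (hk : 0 < k) (v : Vec) : toSphere (k • v) = toSphere v := by
  have h : norm2 (k • v) = k * norm2 v := by
    unfold norm2
    rw [smul_dotProduct, dotProduct_smul, smul_eq_mul, smul_eq_mul, ← mul_assoc,
      Real.sqrt_mul (by positivity), Real.sqrt_mul_self hk.le]
  unfold toSphere
  rw [h, smul_smul, mul_inv, mul_comm k⁻¹, mul_assoc, inv_mul_cancel₀ hk.ne', mul_one]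

theorem discriminator_a (x y z : ℝ) :
    discriminator .a ![x, y, z] = -(x * (y ^ 2 + z ^ 2)) := by
  simp [discriminator, velocity, Contact.axis, crossProduct, dotProduct, Fin.sum_univ_three]
  ring

theorem discriminator_b (x y z : ℝ) :
    discriminator .b ![x, y, z] = -(y * (x ^ 2 + z ^ 2)) := by
  simp [discriminator, velocity, Contact.axis, crossProduct, dotProduct, Fin.sum_univ_three]
  ring

theorem discriminator_c (x y z : ℝ) :
    discriminator .c ![x, y, z] = -(z * (x ^ 2 + y ^ 2)) := by
  simp [discriminator, velocity, Contact.axis, crossProduct, dotProduct, Fin.sum_univ_three]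
  ring

theorem nextContact_pos {k : Contact} {u : Vec} (h : 0 < discriminator k u) :
    nextContact k u = some k.succ := by
  simp [nextContact, h]

theorem nextContact_neg {k : Contact} {u : Vec} (h : discriminator k u < 0) :
    nextContact k u = some k.pred := by
  simp [nextContact, h, not_lt.2 h.le]

theorem after_ba (r x y z : ℝ) : afterCollision r .b .a ![x, y, z] =
    (x * y) • ![x - alpha r * y, -(r * y), -(r * z)] := by
  ext i
  fin_cases i
  all_goals
    simp only [afterCollision, velocity, Contact.axis, Contact.matrix, cross_apply]
    simp [Matrix.mulVec, Matrix.vecHead, Matrix.vecTail]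
    try ring

theorem after_bc (r x y z : ℝ) : afterCollision r .b .c ![x, y, z] =
    (y * z) • ![-(r * x), -(r * y), z - alpha r * y] := by
  ext i
  fin_cases i
  all_goals
    simp only [afterCollision, velocity, Contact.axis, Contact.matrix, cross_apply]
    simp [Matrix.mulVec, Matrix.vecHead, Matrix.vecTail]
    try ring

theorem after_ab (r x y z : ℝ) : afterCollision r .a .b ![x, y, z] =
    (x * y) • ![-(r * x), y - alpha r * (x + z), -(r * z)] := by
  ext i
  fin_cases i
  all_goals
    simp only [afterCollision, velocity, Contact.axis, Contact.matrix, cross_apply]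
    simp [Matrix.mulVec, Matrix.vecHead, Matrix.vecTail]
    try ring

theorem after_cb (r x y z : ℝ) : afterCollision r .c .b ![x, y, z] =
    (y * z) • ![-(r * x), y - alpha r * (x + z), -(r * z)] := by
  ext i
  fin_cases i
  all_goals
    simp only [afterCollision, velocity, Contact.axis, Contact.matrix, cross_apply]
    simp [Matrix.mulVec, Matrix.vecHead, Matrix.vecTail]
    try ring

theorem after_ac (r x y z : ℝ) : afterCollision r .a .c ![x, y, z] =
    (x * z) • ![-(r * x), -(r * y), z - alpha r * y] := by
  ext i
  fin_cases i
  all_goals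
    simp only [afterCollision, velocity, Contact.axis, Contact.matrix, cross_apply]
    simp [Matrix.mulVec, Matrix.vecHead, Matrix.vecTail]
    try ring

theorem after_ca (r x y z : ℝ) : afterCollision r .c .a ![x, y, z] =
    (x * z) • ![x - alpha r * y, -(r * y), -(r * z)] := by
  ext i
  fin_cases i
  all_goals
    simp only [afterCollision, velocity, Contact.axis, Contact.matrix, cross_apply]
    simp [Matrix.mulVec, Matrix.vecHead, Matrix.vecTail]
    try ring

theorem smul_vec3 (k x y z : ℝ) : k • (![x, y, z] : Vec) = ![k * x, k * y, k * z] := by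
  simp

theorem P1_mulVec (r x y z : ℝ) : P1 r *ᵥ ![x, y, z] =
    ![r * (alpha r * y - x), alpha r * (alpha r * y - x) - r * y + r * alpha r * z,
      r ^ 2 * z] := by
  ext i
  fin_cases i <;> simp [P1, Matrix.mulVec, Matrix.vecHead, Matrix.vecTail] <;> ring

theorem P2_mulVec (r x y z : ℝ) : P2 r *ᵥ ![x, y, z] =
    ![-(r * (alpha r * y - x)),
      -(alpha r * (alpha r * y - x)) - alpha r * (alpha r * y - z) + r * y,
      -(r * (alpha r * y - z))] := by
  ext i
  fin_cases i <;> simp [P2, Matrix.mulVec, Matrix.vecHead, Matrix.vecTail] <;> ring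

theorem P3_mulVec (r x y z : ℝ) : P3 r *ᵥ ![x, y, z] =
    ![r ^ 2 * x, alpha r * (alpha r * y - z) - r * y + r * alpha r * x,
      r * (alpha r * y - z)] := by
  ext i
  fin_cases i <;> simp [P3, Matrix.mulVec, Matrix.vecHead, Matrix.vecTail] <;> ring

theorem runToB_quadrant {r x y z : ℝ} (hr : 0 < r) (hx : 0 < x) (hz : z < 0) (hy : y ≠ 0)
    (h1 : alpha r * y - x ≠ 0) (h2 : alpha r * y - z ≠ 0) :
    ∃ w ∈ (letter r ![x, y, z]).words, ∃ k : ℝ, 0 < k ∧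
      runToB r 3 .b ![x, y, z] =
        some (w, k • ((letter r ![x, y, z]).matrix r *ᵥ ![x, y, z])) := by
  have ha : 0 < alpha r := by unfold alpha; linarith
  rcases lt_or_gt_of_ne hy with hy | hy
  · have e1 : nextContact .b ![x, y, z] = some .c :=
      nextContact_pos (by rw [discriminator_b]; nlinarith [mul_pos hx hx, sq_nonneg z])
    have hK : 0 < y * z := mul_pos_of_neg_of_neg hy hz
    set K := y * z with hKdef
    have hyx : alpha r * y - x < 0 := by nlinarith
    have hry : 0 < -(r * y) := by nlinarith
    have hX : 0 < K * (r * x) := by positivity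
    have hs : 0 < (K * -(r * x)) ^ 2 + (K * -(r * y)) ^ 2 := by
      have : K * -(r * x) ≠ 0 := by linarith
      positivity
    rcases lt_or_gt_of_ne h2 with h2 | h2
    · have hl : letter r ![x, y, z] = .three := by
        simp [letter, hy, not_lt.2 hy.le]; linarith
      have hZ : 0 < z - alpha r * y := by linarith
      have e2 : nextContact .c (K • ![-(r * x), -(r * y), z - alpha r * y]) = some .b := by
        rw [smul_vec3]
        refine nextContact_neg ?_
        rw [discriminator_c]
        have := mul_pos (mul_pos hK hZ) hs
        linarith
      refine ⟨[.c, .b], by simp [hl, Block.words],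
        K ^ 3 * (-(r * y) * (z - alpha r * y)), by positivity, ?_⟩
      simp only [runToB, e1, Option.bind_some, after_bc, ← hKdef, e2, reduceCtorEq, if_false,
        if_true, Option.map_some, hl, Block.matrix, P3_mulVec]
      rw [smul_vec3, after_cb, smul_vec3, smul_vec3]
      congr 2
      ext i
      fin_cases i <;> simp <;> ring
    · have hl : letter r ![x, y, z] = .two := by
        simp [letter, not_lt.2 hy.le]; intro; linarith
      have hZ : 0 < alpha r * y - z := by linarith
      have e2 : nextContact .c (K • ![-(r * x), -(r * y), z - alpha r * y]) = some .a := by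
        rw [smul_vec3]
        refine nextContact_pos ?_
        rw [discriminator_c]
        have := mul_pos (mul_pos hK hZ) hs
        nlinarith
      set L := K ^ 3 * ((r * x) * (alpha r * y - z)) with hLdef
      have hL : 0 < L := by positivity
      have e3 : afterCollision r .c .a (K • ![-(r * x), -(r * y), z - alpha r * y]) =
          L • ![r * (alpha r * y - x), r * (r * y), r * (alpha r * y - z)] := by
        have : -(r * x) - alpha r * -(r * y) = r * (alpha r * y - x) := by ring
        rw [smul_vec3, after_ca, smul_vec3, smul_vec3]
        ext i
        fin_cases i <;> simp [hLdef] <;> ring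
      have e4 : nextContact .a
          (L • ![r * (alpha r * y - x), r * (r * y), r * (alpha r * y - z)]) = some .b := by
        rw [smul_vec3]
        refine nextContact_pos ?_
        rw [discriminator_a]
        have h3 : 0 < (L * (r * (alpha r * y - z))) ^ 2 := by positivity
        have h4 : 0 < L * (r * (x - alpha r * y)) :=
          mul_pos hL (mul_pos hr (by linarith))
        have := mul_pos h4 (add_pos_of_nonneg_of_pos (sq_nonneg (L * (r * (r * y)))) h3)
        linarith
      have hk : 0 < (x - alpha r * y) * (-(r * y)) := mul_pos (by linarith) hry
      refine ⟨[.c, .a, .b], by simp [hl, Block.words],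
        L ^ 3 * r ^ 3 * ((x - alpha r * y) * (-(r * y))), by positivity, ?_⟩
      simp only [runToB, e1, Option.bind_some, after_bc, ← hKdef, e2, e3, e4, reduceCtorEq,
        if_false, if_true, Option.map_some, hl, Block.matrix, P2_mulVec]
      rw [smul_vec3 L, after_ab, smul_vec3, smul_vec3]
      congr 2
      ext i
      fin_cases i <;> simp <;> ring
  · have e1 : nextContact .b ![x, y, z] = some .a :=
      nextContact_neg (by rw [discriminator_b]; nlinarith [mul_pos hx hx, sq_nonneg z])
    have hK : 0 < x * y := mul_pos hx hy
    set K := x * y with hKdef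
    have hyz : 0 < alpha r * y - z := by nlinarith
    have hrz : 0 < -(r * z) := by nlinarith
    have hs : 0 < (K * -(r * y)) ^ 2 + (K * -(r * z)) ^ 2 := by positivity
    rcases lt_or_gt_of_ne h1 with h1 | h1
    · have hl : letter r ![x, y, z] = .two := by
        simp [letter, not_lt.2 hy.le]; intro; linarith
      have hX : 0 < x - alpha r * y := by linarith
      have e2 : nextContact .a (K • ![x - alpha r * y, -(r * y), -(r * z)]) = some .c := by
        rw [smul_vec3]
        refine nextContact_neg ?_
        rw [discriminator_a]
        have := mul_pos (mul_pos hK hX) hs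
        linarith
      set L := K ^ 3 * ((x - alpha r * y) * (-(r * z))) with hLdef
      have hL : 0 < L := by positivity
      have e3 : afterCollision r .a .c (K • ![x - alpha r * y, -(r * y), -(r * z)]) =
          L • ![r * (alpha r * y - x), r * (r * y), r * (alpha r * y - z)] := by
        rw [smul_vec3, after_ac, smul_vec3, smul_vec3]
        ext i
        fin_cases i <;> simp [hLdef] <;> ring
      have e4 : nextContact .c
          (L • ![r * (alpha r * y - x), r * (r * y), r * (alpha r * y - z)]) = some .b := by
        rw [smul_vec3]
        refine nextContact_neg ?_
        rw [discriminator_c]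
        have h3 : 0 < (L * (r * (r * y))) ^ 2 := by positivity
        have h4 : 0 < L * (r * (alpha r * y - z)) := by positivity
        have := mul_pos h4
          (add_pos_of_nonneg_of_pos (sq_nonneg (L * (r * (alpha r * y - x)))) h3)
        linarith
      refine ⟨[.a, .c, .b], by simp [hl, Block.words],
        L ^ 3 * r ^ 4 * ((alpha r * y - z) * y), by positivity, ?_⟩
      simp only [runToB, e1, Option.bind_some, after_ba, ← hKdef, e2, e3, e4, reduceCtorEq,
        if_false, if_true, Option.map_some, hl, Block.matrix, P2_mulVec]
      rw [smul_vec3 L, after_cb, smul_vec3, smul_vec3]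
      congr 2
      ext i
      fin_cases i <;> simp <;> ring
    · have hl : letter r ![x, y, z] = .one := by
        unfold letter
        exact if_pos ⟨hy, h1⟩
      have hX : 0 < alpha r * y - x := by linarith
      have e2 : nextContact .a (K • ![x - alpha r * y, -(r * y), -(r * z)]) = some .b := by
        rw [smul_vec3]
        refine nextContact_pos ?_
        rw [discriminator_a]
        have := mul_pos (mul_pos hK hX) hs
        nlinarith
      refine ⟨[.a, .b], by simp [hl, Block.words],
        K ^ 3 * ((r * y) * (alpha r * y - x)), by positivity, ?_⟩
      simp only [runToB, e1, Option.bind_some, after_ba, ← hKdef, e2, reduceCtorEq, if_false,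
        if_true, Option.map_some, hl, Block.matrix, P1_mulVec]
      rw [smul_vec3, after_ab, smul_vec3, smul_vec3]
      congr 2
      ext i
      fin_cases i <;> simp <;> ring

/-- Away from the degenerate configurations, `bMap` is the normalized result of the collisions,
and the letter of a point tells which collisions occur. -/
theorem bMap_eq_collisions {r : ℝ} (hr : 0 < r) {u : Vec} (hu : u ∈ domX)
    (hx : u 0 ≠ 0) (hy : u 1 ≠ 0) (hz : u 2 ≠ 0)
    (h1 : alpha r * u 1 - u 0 ≠ 0) (h2 : alpha r * u 1 - u 2 ≠ 0) :
    ∃ w ∈ (code r u).words, ∃ u' : Vec, bToB r u = some (w, u') ∧ toSphere u' = bMap r u := by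
  obtain ⟨x, y, z, ho, hx', hz', hy', h1', h2'⟩ : ∃ x y z : ℝ, orient u = ![x, y, z] ∧
      0 < x ∧ z < 0 ∧ y ≠ 0 ∧ alpha r * y - x ≠ 0 ∧ alpha r * y - z ≠ 0 := by
    by_cases h : 0 ≤ u 0 ∧ u 2 ≤ 0
    · refine ⟨u 0, u 1, u 2, ?_, lt_of_le_of_ne h.1 hx.symm, lt_of_le_of_ne h.2 hz, hy, h1, h2⟩
      ext i
      fin_cases i <;> simp [orient, h]
    · have h' : u 0 ≤ 0 ∧ 0 ≤ u 2 := hu.2.resolve_left h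
      refine ⟨-u 0, -u 1, -u 2, ?_, neg_pos.2 (lt_of_le_of_ne h'.1 hx),
        neg_neg_of_pos (lt_of_le_of_ne h'.2 hz.symm), neg_ne_zero.2 hy, ?_, ?_⟩
      · ext i
        fin_cases i <;> simp [orient, h]
      · intro h3; exact h1 (by linarith)
      · intro h3; exact h2 (by linarith)
  obtain ⟨w, hw, k, hk, he⟩ := runToB_quadrant hr hx' hz' hy' h1' h2'
  refine ⟨w, ?_, k • ((letter r ![x, y, z]).matrix r *ᵥ ![x, y, z]), ?_, ?_⟩
  · rw [code, ho]; exact hw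
  · rw [bToB, ho]; exact he
  · rw [bMap, code, ho]; exact toSphere_smul hk _

/-! ### Periodic orbits, dominating eigenvectors, stability -/

/-- `u` is a point of `X` that generates a periodic orbit with the given pattern: the successive
iterates of the `b`-to-`b` mapping carry the letters of the pattern, and the orbit closes up
after one period. -/
def GeneratesPattern (r : ℝ) {n : ℕ} (s : Fin n → Block) (u : Vec) : Prop :=
  u ∈ domX ∧ (∀ k : Fin n, code r ((bMap r)^[k] u) = s k) ∧ (bMap r)^[n] u = u

/-- Along the orbit of `u`, the collisions of the particles follow the given pattern. -/
def CollisionsFollow (r : ℝ) {n : ℕ} (s : Fin n → Block) (u : Vec) : Prop :=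
  ∀ k : Fin n, ∃ w ∈ (s k).words, ∃ u' : Vec,
    bToB r ((bMap r)^[k] u) = some (w, u') ∧ toSphere u' = bMap r ((bMap r)^[k] u)

/-- The pattern `132312`. -/
def pattern132312 : Fin 6 → Block := ![.one, .three, .two, .three, .one, .two]

/-- The reduced collision matrix `J P₂ P₃ P₁` of the pattern. -/
def reducedMatrix (r : ℝ) : Matrix (Fin 3) (Fin 3) ℝ := J * P2 r * P3 r * P1 r

/-- `l` is the dominating eigenvalue of `M`: a simple eigenvalue, of modulus strictly larger than
that of all the other (real or complex) eigenvalues. -/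
def IsDominatingEigenvalue (M : Matrix (Fin 3) (Fin 3) ℝ) (l : ℝ) : Prop :=
  M.charpoly.rootMultiplicity l = 1 ∧
    ∀ m : ℂ, Polynomial.aeval m M.charpoly = 0 → m ≠ (l : ℂ) → ‖m‖ < |l|

/-- `u` is an eigenvector for the dominating eigenvalue of `M`, normalized by `u_x = 1`. -/
def IsDominatingEigenvector (M : Matrix (Fin 3) (Fin 3) ℝ) (u : Vec) : Prop :=
  (∃ l : ℝ, IsDominatingEigenvalue M l ∧ M *ᵥ u = l • u) ∧ u 0 = 1

/-- The orbit of `u` under `f : X → X` is locally (asymptotically) stable: orbits that start in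
`X` close enough to `u` remain arbitrarily close to the orbit of `u`, and converge to it. -/
def IsLocallyStableOrbit (f : Vec → Vec) (X : Set Vec) (u : Vec) : Prop :=
  (∀ ε > 0, ∃ δ > 0, ∀ v ∈ X, norm2 (v - u) < δ → ∀ n : ℕ, norm2 (f^[n] v - f^[n] u) < ε) ∧
    ∃ δ > 0, ∀ v ∈ X, norm2 (v - u) < δ →
      Tendsto (fun n : ℕ => norm2 (f^[n] v - f^[n] u)) atTop (𝓝 0)

end

end FourSpheres

open FourSpheres

/-!
Conjugation by `J` exchanges `P₁` and `P₃` and fixes `P₂`, so one period of the word `132312` acts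
as the square of `M = J P₂ P₃ P₁`. The characteristic polynomial of `-M` is a real cubic which is
negative at a point beyond `r⁴`; it therefore has a largest real root `l > r⁴`, and the Schur–Cohn
criterion for the quadratic cofactor shows that `l` dominates.

Let `M u = -l u` with `u_x = 1`, and put `A = αy - x` and `D = -(P₃ P₁ u)_y`. The three eigenvector
equations give `(l² - r⁸) A = α D (r⁵ - (1 - 4r + r²) l / 2)`, so `A` has the sign of the last
factor as soon as `D > 0`. Eliminating `l` between the vanishing of this factor and the cubic
leaves a quartic in `r`, strictly decreasing on `[0, 1]`, whose root is the critical value.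

When `A > 0`, the orbit of `u` visits the interiors of the cones that define the pattern. Conversely
a point `v` generating the pattern satisfies `M² v = m² v` with `m > 0`; the sign conditions exclude
`M v = m v`, which leaves `M v = -l v`. Finally `(-l⁻¹ M)ⁿ` converges to the spectral projection, so
the normalized power iteration is stable at `u / |u|`, and every second step of it agrees with the
sixth iterate of the mapping near that point.
-/

namespace FourSpheres

/-- The cubic `x³ + t x² + s x - d`. Its roots are the opposites of those of
`X³ - t X² + s X + d`, the shape of the characteristic polynomials studied here. -/
noncomputable def cubic (t s d x : ℝ) : ℝ := x ^ 3 + t * x ^ 2 + s * x - d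

/-- The quotient of `cubic t s d` by `x - l`, when `l` is a root; see `cubic_eq_mul`. -/
noncomputable def cubicCofactor (t d l x : ℝ) : ℝ := x ^ 2 + (l + t) * x + d / l

section Cubic

variable {t s d l L x : ℝ}

theorem continuous_cubic (t s d : ℝ) : Continuous (cubic t s d) := by
  unfold cubic
  fun_prop

theorem cubic_pos_of_large (hx1 : 1 ≤ x) (hx : |t| + |s| + |d| < x) : 0 < cubic t s d x := by
  have h2 : 1 ≤ x ^ 2 := one_le_pow₀ hx1
  have h1 : x ≤ x ^ 2 := le_self_pow₀ hx1 two_ne_zero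
  have ht : -|t| * x ^ 2 ≤ t * x ^ 2 := mul_le_mul_of_nonneg_right (neg_abs_le t) (sq_nonneg x)
  have hs : -|s| * x ^ 2 ≤ s * x :=
    calc -|s| * x ^ 2 ≤ -|s| * x := mul_le_mul_of_nonpos_left h1 (neg_nonpos.2 (abs_nonneg s))
      _ ≤ s * x := mul_le_mul_of_nonneg_right (neg_abs_le s) (by linarith)
  have hd : d ≤ |d| * x ^ 2 := (le_abs_self d).trans (le_mul_of_one_le_right (abs_nonneg d) h2)
  have : (|t| + |s| + |d|) * x ^ 2 < x * x ^ 2 := mul_lt_mul_of_pos_right hx (by linarith)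
  unfold cubic
  linarith

theorem exists_cubic_eq_zero_gt (hL : cubic t s d L < 0) : ∃ x > L, cubic t s d x = 0 := by
  obtain ⟨R, hR1, hR⟩ : ∃ R, 1 ≤ R ∧ |t| + |s| + |d| < R :=
    ⟨|t| + |s| + |d| + 1, by simp only [le_add_iff_nonneg_left]; positivity, by linarith⟩
  have hpos : 0 < cubic t s d (max L R) :=
    cubic_pos_of_large (hR1.trans (le_max_right L R)) (hR.trans_le (le_max_right L R))
  obtain ⟨x, hx, hx0⟩ := intermediate_value_Ioo (le_max_left L R)
    (continuous_cubic t s d).continuousOn ⟨hL, hpos⟩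
  exact ⟨x, hx.1, hx0⟩

theorem exists_isGreatest_cubic_eq_zero (hL : cubic t s d L < 0) :
    ∃ l, IsGreatest {x | cubic t s d x = 0} l := by
  obtain ⟨x, -, hx⟩ := exists_cubic_eq_zero_gt hL
  refine ⟨_, (isClosed_eq (continuous_cubic t s d) continuous_const).isGreatest_csSup ⟨x, hx⟩
    ⟨max 1 (|t| + |s| + |d|), fun y (hy : cubic t s d y = 0) => ?_⟩⟩
  by_contra! h
  exact (cubic_pos_of_large ((le_max_left _ _).trans h.le)
    ((le_max_right _ _).trans_lt h)).ne' hy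

theorem lt_of_cubic_neg (hl : IsGreatest {x | cubic t s d x = 0} l) (hL : cubic t s d L < 0) :
    L < l := by
  obtain ⟨x, hLx, hx⟩ := exists_cubic_eq_zero_gt hL
  exact hLx.trans_le (hl.2 hx)

theorem cubic_eq_mul (hl0 : l ≠ 0) (hl : cubic t s d l = 0) (x : ℝ) :
    cubic t s d x = (x - l) * cubicCofactor t d l x := by
  unfold cubic cubicCofactor at *
  field_simp
  linear_combination x * hl

theorem cubicCofactor_pos (hd : 0 < d) (hl : 0 < l) (ht : 0 ≤ l + t) (hx : 0 < x) :
    0 < cubicCofactor t d l x := by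
  unfold cubicCofactor
  positivity

/-- `cubicCofactor t d l x / x` is nondecreasing beyond `√(d / l)`, hence beyond `L`, where it is
positive. -/
theorem cubicCofactor_pos_of_le (hL0 : 0 < L) (hdL : d ≤ L ^ 3) (hL : cubic t s d L < 0)
    (hl : cubic t s d l = 0) (hLl : L < l) (hLx : L ≤ x) : 0 < cubicCofactor t d l x := by
  have hl0 : 0 < l := hL0.trans hLl
  have hfL : 0 < cubicCofactor t d l L := by
    rw [cubic_eq_mul hl0.ne' hl] at hL
    exact pos_of_mul_neg_right hL (by linarith)
  have hp : d / l ≤ L * x :=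
    calc d / l ≤ L ^ 2 := by rw [div_le_iff₀ hl0]; nlinarith [pow_pos hL0 2]
      _ ≤ L * x := by nlinarith
  have key : L * cubicCofactor t d l x =
      x * cubicCofactor t d l L + (x - L) * (L * x - d / l) := by
    unfold cubicCofactor
    ring
  refine pos_of_mul_pos_right (a := L) ?_ hL0.le
  rw [key]
  have := mul_pos (hL0.trans_le hLx) hfL
  have := mul_nonneg (sub_nonneg.2 hLx) (sub_nonneg.2 hp)
  linarith

theorem add_pos_of_isGreatest (hdt : 0 < d + t * s)
    (hl : IsGreatest {x | cubic t s d x = 0} l) : 0 < l + t := by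
  have : -t < l := lt_of_cubic_neg hl (by unfold cubic; linarith)
  linarith

theorem mul_sq_lt_of_cubic_eq_zero (hd : 0 < d) (hl0 : 0 < l) (ht : t ≤ 0 ∨ 0 < d + t * s)
    (hl : cubic t s d l = 0) : t * l ^ 2 < d := by
  rcases le_or_gt t 0 with ht0 | ht0
  · exact (mul_nonpos_of_nonpos_of_nonneg ht0 (sq_nonneg l)).trans_lt hd
  have hdt := ht.resolve_left ht0.not_ge
  by_contra! h
  have h1 : t * s * l = t * (d - t * l ^ 2) - t * l ^ 3 := by
    unfold cubic at hl
    linear_combination t * hl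
  have h2 : t * (d - t * l ^ 2) ≤ 0 := mul_nonpos_of_nonneg_of_nonpos ht0.le (by linarith)
  have h3 : l * d ≤ l * (t * l ^ 2) := mul_le_mul_of_nonneg_left h hl0.le
  linarith [mul_pos hdt hl0]

end Cubic

section Quadratic

variable {b p l : ℝ}

theorem lt_of_quadratic_eq_zero (hl : 0 < l) (hp : p < l ^ 2) (hf : 0 < l ^ 2 + b * l + p) {m : ℝ}
    (hm : m ^ 2 + b * m + p = 0) : m < l := by
  by_contra! h
  have key : m * (l ^ 2 + b * l + p) = (l - m) * (m * l - p) := by linear_combination l * hm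
  have : 0 < m * (l ^ 2 + b * l + p) := mul_pos (hl.trans_le h) hf
  have : 0 ≤ (m - l) * (m * l - p) := mul_nonneg (by linarith) (by nlinarith)
  linarith

/-- The Schur–Cohn criterion for a quadratic polynomial and the disc of radius `l`. -/
theorem norm_lt_of_quadratic_eq_zero (hl : 0 < l) (hp : p < l ^ 2) (hf : 0 < l ^ 2 + b * l + p)
    (hf' : 0 < l ^ 2 - b * l + p) {m : ℂ} (hm : m ^ 2 + b * m + p = 0) : ‖m‖ < l := by
  have hre : m.re ^ 2 - m.im ^ 2 + b * m.re + p = 0 := by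
    simpa [pow_two] using congrArg Complex.re hm
  have him : m.im * (2 * m.re + b) = 0 := by
    have := congrArg Complex.im hm
    simp only [pow_two, Complex.add_im, Complex.mul_im, Complex.ofReal_re, Complex.ofReal_im,
      zero_mul, add_zero, Complex.zero_im] at this
    linear_combination this
  suffices m.re ^ 2 + m.im ^ 2 < l ^ 2 by
    rw [Complex.norm_eq_sqrt_sq_add_sq]
    exact (Real.sqrt_lt' hl).2 this
  rcases mul_eq_zero.1 him with h | h
  · have hx : m.re ^ 2 + b * m.re + p = 0 := by rw [h] at hre; linear_combination hre
    have h1 : m.re < l := lt_of_quadratic_eq_zero hl hp hf hx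
    have h2 : -m.re < l := lt_of_quadratic_eq_zero (b := -b) hl hp (by linarith)
      (by linear_combination hx)
    rw [h]
    nlinarith
  · have : m.re ^ 2 + m.im ^ 2 = p := by linear_combination -hre + m.re * h
    linarith

end Quadratic

section DominatingEigenvalue

open Polynomial

variable {M : Matrix (Fin 3) (Fin 3) ℝ} {t s d l m : ℝ}

theorem charpoly_eq_mul_cubicCofactor (hM : M.charpoly = X ^ 3 - C t * X ^ 2 + C s * X + C d)
    (hl0 : l ≠ 0) (hl : cubic t s d l = 0) :
    M.charpoly = (X - C (-l)) * (X ^ 2 - C (l + t) * X + C (d / l)) := by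
  have hs : s = d / l - l * (l + t) := by
    unfold cubic at hl
    field_simp
    linear_combination hl
  have hd : d = l * (d / l) := (mul_div_cancel₀ d hl0).symm
  rw [hM, hs]
  nth_rewrite 2 [hd]
  simp only [C_sub, C_mul, C_add, C_neg]
  ring

theorem isDominatingEigenvalue_neg (hM : M.charpoly = X ^ 3 - C t * X ^ 2 + C s * X + C d)
    {L : ℝ} (hd : 0 < d) (hL0 : 0 < L) (hdL : d ≤ L ^ 3) (hL : cubic t s d L < 0)
    (ht : t ≤ 0 ∨ 0 < d + t * s) (hl : IsGreatest {x | cubic t s d x = 0} l) :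
    IsDominatingEigenvalue M (-l) := by
  have hLl : L < l := lt_of_cubic_neg hl hL
  have hl0 : 0 < l := hL0.trans hLl
  have hfac := charpoly_eq_mul_cubicCofactor hM hl0.ne' hl.1
  have hf : 0 < l ^ 2 + (l + t) * l + d / l :=
    cubicCofactor_pos_of_le hL0 hdL hL hl.1 hLl hLl.le
  have hf' : 0 < l ^ 2 - (l + t) * l + d / l := by
    have : t * l < d / l := by
      rw [lt_div_iff₀ hl0]
      linarith [mul_sq_lt_of_cubic_eq_zero hd hl0 ht hl.1]
    linarith
  have hp : d / l < l ^ 2 := by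
    rw [div_lt_iff₀ hl0, ← pow_succ]
    exact hdL.trans_lt (by gcongr)
  constructor
  · have h0 := M.charpoly_monic.ne_zero
    rw [hfac] at h0 ⊢
    rw [rootMultiplicity_mul h0, rootMultiplicity_X_sub_C_self, rootMultiplicity_eq_zero]
    simp only [IsRoot.def, eval_add, eval_sub, eval_mul, eval_pow, eval_X, eval_C]
    linarith
  · intro m hm hne
    have hq : m ^ 2 - (l + t) * m + (d / l : ℝ) = 0 := by
      rw [hfac, map_mul, mul_eq_zero] at hm
      simpa using hm.resolve_left fun h => hne (by simpa [add_eq_zero_iff_eq_neg] using h)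
    rw [abs_neg, abs_of_pos hl0]
    refine norm_lt_of_quadratic_eq_zero (b := -(l + t)) hl0 hp (by linarith) (by linarith) ?_
    push_cast at hq ⊢
    linear_combination hq

theorem IsDominatingEigenvalue.isRoot (h : IsDominatingEigenvalue M l) : M.charpoly.IsRoot l :=
  (rootMultiplicity_pos M.charpoly_monic.ne_zero).1 (by rw [h.1]; exact one_pos)

theorem IsDominatingEigenvalue.abs_lt (h : IsDominatingEigenvalue M l)
    (hm : M.charpoly.IsRoot m) (hne : m ≠ l) : |m| < |l| := by
  have := h.2 m ((aeval_algebraMap_apply_eq_algebraMap_eval m M.charpoly).trans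
    (by rw [hm.eq_zero, map_zero])) (by exact_mod_cast hne)
  simpa using this

theorem IsDominatingEigenvalue.unique (hl : IsDominatingEigenvalue M l)
    (hm : IsDominatingEigenvalue M m) : m = l := by
  by_contra hne
  exact lt_asymm (hl.abs_lt hm.isRoot hne) (hm.abs_lt hl.isRoot (Ne.symm hne))

end DominatingEigenvalue

theorem alpha_pos {r : ℝ} (hr : 0 < r) : 0 < alpha r := by
  unfold alpha
  linarith

theorem alpha_sq_sub (r : ℝ) : alpha r ^ 2 - r = (1 - r) ^ 2 / 4 := by
  unfold alpha
  ring

/-- The trace of `reducedMatrix r`. -/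
noncomputable def reducedTrace (r : ℝ) : ℝ :=
  (-1 + 8 * r - 21 * r ^ 2 + 29 * r ^ 4 + 24 * r ^ 5 - 7 * r ^ 6) / 32

/-- The sum of the principal `2 × 2` minors of `reducedMatrix r`. -/
noncomputable def reducedMinorSum (r : ℝ) : ℝ :=
  (7 * r ^ 5 - 24 * r ^ 6 - 29 * r ^ 7 + 21 * r ^ 9 - 8 * r ^ 10 + r ^ 11) / 32

/-- The cubic whose roots are the opposites of the eigenvalues of `reducedMatrix r`. -/
noncomputable def reducedCubic (r : ℝ) : ℝ → ℝ :=
  cubic (reducedTrace r) (reducedMinorSum r) (r ^ 11)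

/-- `l` is the largest real root of `reducedCubic r`; for `0 < r < 1` this means that `-l` is the
dominating eigenvalue of `reducedMatrix r`. -/
def IsLargestRoot (r l : ℝ) : Prop := IsGreatest {x | reducedCubic r x = 0} l

section Charpoly

open Polynomial

theorem charpoly_fin_three {R : Type*} [CommRing R] (M : Matrix (Fin 3) (Fin 3) R) :
    M.charpoly = X ^ 3 - C M.trace * X ^ 2 +
      C (M 0 0 * M 1 1 - M 0 1 * M 1 0 + (M 0 0 * M 2 2 - M 0 2 * M 2 0) +
        (M 1 1 * M 2 2 - M 1 2 * M 2 1)) * X - C M.det := by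
  rw [Matrix.charpoly, Matrix.det_fin_three, Matrix.det_fin_three, Matrix.trace_fin_three]
  simp
  ring

theorem det_reducedMatrix (r : ℝ) : (reducedMatrix r).det = -r ^ 11 := by
  simp only [reducedMatrix, Matrix.det_mul]
  simp [J, P1, P2, P3, Matrix.det_fin_three]
  ring

theorem trace_reducedMatrix (r : ℝ) : (reducedMatrix r).trace = reducedTrace r := by
  simp [Matrix.trace_fin_three, reducedMatrix, J, P1, P2, P3, alpha, reducedTrace]
  ring

theorem charpoly_reducedMatrix (r : ℝ) : (reducedMatrix r).charpoly =
    X ^ 3 - C (reducedTrace r) * X ^ 2 + C (reducedMinorSum r) * X + C (r ^ 11) := by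
  rw [charpoly_fin_three, det_reducedMatrix, trace_reducedMatrix, C_neg, sub_neg_eq_add]
  congr 4
  simp [reducedMatrix, J, P1, P2, P3, Matrix.mul_apply, Fin.sum_univ_three, alpha,
    reducedMinorSum]
  ring

theorem isRoot_charpoly_reducedMatrix_neg {r x : ℝ} :
    (reducedMatrix r).charpoly.IsRoot (-x) ↔ reducedCubic r x = 0 := by
  have : (reducedMatrix r).charpoly.eval (-x) = -reducedCubic r x := by
    simp only [charpoly_reducedMatrix, reducedCubic, cubic, eval_add, eval_sub, eval_mul, eval_pow,
      eval_X, eval_C]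
    ring
  rw [IsRoot.def, this, neg_eq_zero]

end Charpoly

section LargestRoot

variable {r l x : ℝ}

/-- The polynomial in `r` is `-864 / (r ^ 6 * (1 - r))` times the value of the cubic. -/
theorem reducedCubic_neg (hr0 : 0 < r) (hr1 : r < 1) :
    reducedCubic r (r ^ 3 * (1 + 2 * r) / 3) < 0 := by
  have hid : reducedCubic r (r ^ 3 * (1 + 2 * r) / 3) = -(r ^ 6 * (1 - r) / 864 *
      (3 - 9 * r - 93 * r ^ 2 + 121 * r ^ 3 + 787 * r ^ 4 + 1369 * r ^ 5 + 309 * r ^ 6 -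
        201 * r ^ 7 + 18 * r ^ 8)) := by
    unfold reducedCubic cubic reducedTrace reducedMinorSum
    ring
  have h6 : 0 < r ^ 6 * (309 - 201 * r) :=
    mul_pos (by positivity) (by linarith)
  have h5 : 0 < 3 - 9 * r - 93 * r ^ 2 + 121 * r ^ 3 + 787 * r ^ 4 + 1369 * r ^ 5 := by
    nlinarith [mul_nonneg (pow_nonneg hr0.le 3) (sq_nonneg (r - 19 / 100)),
      sq_nonneg (36 * r ^ 2 + r - 3 / 2), sq_nonneg (r - 1 / 5)]
  rw [hid, neg_lt_zero]
  have : 0 < 1 - r := by linarith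
  have : 0 < r ^ 8 := by positivity
  have : 0 < 3 - 9 * r - 93 * r ^ 2 + 121 * r ^ 3 + 787 * r ^ 4 + 1369 * r ^ 5 + 309 * r ^ 6 -
      201 * r ^ 7 + 18 * r ^ 8 := by linarith
  positivity

theorem reducedTrace_nonpos (hr0 : 0 < r) (hr : r ≤ 11 / 50) : reducedTrace r ≤ 0 := by
  have h2 : 8 * r - 21 * r ^ 2 ≤ 16 / 21 := by linarith [sq_nonneg (21 * r - 4)]
  have h4 : r ^ 4 ≤ (11 / 50) ^ 4 := by gcongr
  have h5 : r ^ 5 ≤ (11 / 50) ^ 5 := by gcongr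
  unfold reducedTrace
  linarith [pow_pos hr0 6]

/-- The left-hand side is `r ^ 9 * (1 - r) ^ 2 * (1 + r) ^ 2 / 1024` times a quartic polynomial
in `r + r⁻¹`, which is expanded in the Bernstein basis of `[2, 24 / 5]`. -/
theorem pow_add_reducedTrace_mul_pos (hr : 11 / 50 < r) (hr1 : r < 1) :
    0 < r ^ 11 + reducedTrace r * reducedMinorSum r := by
  have hr0 : 0 < r := by linarith
  have : 0 < (1 - r) ^ 2 := pow_pos (by linarith) 2
  obtain ⟨b, hb⟩ : ∃ b, b = 24 / 5 * r - 1 - r ^ 2 := ⟨_, rfl⟩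
  have hb0 : 0 < b := by nlinarith
  have hid : r ^ 11 + reducedTrace r * reducedMinorSum r =
      r ^ 5 * (1 - r) ^ 2 * (1 + r) ^ 2 / 1024 * ((5 / 14) ^ 4 *
        (512 * b ^ 4 + 6656 / 5 * ((1 - r) ^ 2 * b ^ 3) +
          26176 / 25 * (((1 - r) ^ 2) ^ 2 * b ^ 2) + 84416 / 125 * (((1 - r) ^ 2) ^ 3 * b) +
          10768 / 625 * ((1 - r) ^ 2) ^ 4)) := by
    rw [hb]
    unfold reducedTrace reducedMinorSum
    ring
  rw [hid]
  positivity

theorem exists_isLargestRoot (hr0 : 0 < r) (hr1 : r < 1) : ∃ l, IsLargestRoot r l :=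
  exists_isGreatest_cubic_eq_zero (reducedCubic_neg hr0 hr1)

theorem IsLargestRoot.isDominatingEigenvalue (h : IsLargestRoot r l) (hr0 : 0 < r) (hr1 : r < 1) :
    IsDominatingEigenvalue (reducedMatrix r) (-l) := by
  have amgm : r ^ 11 ≤ (r ^ 3 * (1 + 2 * r) / 3) ^ 3 := by
    have : (r ^ 3 * (1 + 2 * r) / 3) ^ 3 - r ^ 11 =
        r ^ 9 * ((1 - r) ^ 2 * (1 + 8 * r) / 27) := by ring
    have : 0 ≤ r ^ 9 * ((1 - r) ^ 2 * (1 + 8 * r) / 27) := by positivity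
    linarith
  refine isDominatingEigenvalue_neg (charpoly_reducedMatrix r) (by positivity) (by positivity) amgm
    (reducedCubic_neg hr0 hr1) ?_ h
  rcases le_or_gt r (11 / 50) with hr | hr
  · exact .inl (reducedTrace_nonpos hr0 hr)
  · exact .inr (pow_add_reducedTrace_mul_pos hr hr1)

theorem IsLargestRoot.pow_lt (h : IsLargestRoot r l) (hr0 : 0 < r) (hr1 : r < 1) : r ^ 4 < l := by
  refine lt_of_le_of_lt ?_ (lt_of_cubic_neg h (reducedCubic_neg hr0 hr1))
  have : 0 ≤ r ^ 3 * (1 - r) := mul_nonneg (by positivity) (by linarith)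
  linarith

theorem IsLargestRoot.pos (h : IsLargestRoot r l) (hr0 : 0 < r) (hr1 : r < 1) : 0 < l :=
  (pow_pos hr0 4).trans (h.pow_lt hr0 hr1)

end LargestRoot

theorem vec3_eta (u : Vec) : ![u 0, u 1, u 2] = u := FinVec.etaExpand_eq u

theorem P1_mulVec_eq (r : ℝ) (u : Vec) : P1 r *ᵥ u =
    ![r * (alpha r * u 1 - u 0),
      alpha r * (alpha r * u 1 - u 0) - r * u 1 + r * alpha r * u 2, r ^ 2 * u 2] := by
  rw [← P1_mulVec, vec3_eta]

theorem P2_mulVec_eq (r : ℝ) (u : Vec) : P2 r *ᵥ u =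
    ![-(r * (alpha r * u 1 - u 0)),
      -(alpha r * (alpha r * u 1 - u 0)) - alpha r * (alpha r * u 1 - u 2) + r * u 1,
      -(r * (alpha r * u 1 - u 2))] := by
  rw [← P2_mulVec, vec3_eta]

theorem P3_mulVec_eq (r : ℝ) (u : Vec) : P3 r *ᵥ u =
    ![r ^ 2 * u 0, alpha r * (alpha r * u 1 - u 2) - r * u 1 + r * alpha r * u 0,
      r * (alpha r * u 1 - u 2)] := by
  rw [← P3_mulVec, vec3_eta]

theorem J_mulVec (u : Vec) : J *ᵥ u = ![u 2, u 1, u 0] := by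
  ext i
  fin_cases i <;> simp [J, Matrix.mulVec, dotProduct, Fin.sum_univ_three]

theorem reducedMatrix_mulVec (r : ℝ) (u : Vec) :
    reducedMatrix r *ᵥ u = J *ᵥ (P2 r *ᵥ (P3 r *ᵥ (P1 r *ᵥ u))) := by
  simp only [reducedMatrix, Matrix.mulVec_mulVec, Matrix.mul_assoc]

/-- The quantity `αy - x`: where `y > 0`, its sign decides between the letters `1` and `2`. -/
noncomputable def excess (r : ℝ) (u : Vec) : ℝ := alpha r * u 1 - u 0

/-- The opposite of the middle coordinate of `P₃ P₁ u`. -/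
noncomputable def depth (r : ℝ) (u : Vec) : ℝ := -(P3 r *ᵥ (P1 r *ᵥ u)) 1

/-- For an eigenvector, the ratio of `excess` to `depth` is a positive multiple of `margin r l`;
see `excess_eq_depth_mul_margin`. -/
noncomputable def margin (r l : ℝ) : ℝ := r ^ 5 - (1 - 4 * r + r ^ 2) / 2 * l

/-- The determinant, up to a factor `r`, of the linear system satisfied by `excess r u` and
`depth r u` when `u` is an eigenvector. -/
noncomputable def eigenDet (r l : ℝ) : ℝ :=
  (alpha r ^ 2 * r ^ 3 + l) * alpha r * margin r l +
    alpha r * (alpha r ^ 2 - r) * (l ^ 2 - r ^ 8)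

section Eigenvector

variable {r l : ℝ} {u : Vec}

theorem P3_mulVec_P1_mulVec_zero (r : ℝ) (u : Vec) :
    (P3 r *ᵥ (P1 r *ᵥ u)) 0 = r ^ 3 * excess r u := by
  simp only [P3_mulVec_eq, P1_mulVec_eq, excess, Matrix.cons_val]
  ring

theorem mul_P3_mulVec_P1_mulVec_two (r : ℝ) (u : Vec) :
    (alpha r ^ 2 - r) * (P3 r *ᵥ (P1 r *ᵥ u)) 2 =
      r ^ 4 * u 2 - r ^ 3 * alpha r ^ 2 * excess r u - r * alpha r * depth r u := by
  simp only [depth, P3_mulVec_eq, P1_mulVec_eq, excess, Matrix.cons_val]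
  ring

theorem mul_P3_mulVec_P1_mulVec_two_of_eigenvector (hu : reducedMatrix r *ᵥ u = (-l) • u) :
    r * (P3 r *ᵥ (P1 r *ᵥ u)) 2 = -(r * alpha r * depth r u) - l * u 0 := by
  rw [reducedMatrix_mulVec, J_mulVec, P2_mulVec_eq] at hu
  have h0 := congrFun hu 0
  simp only [Matrix.cons_val, Pi.smul_apply, smul_eq_mul] at h0
  rw [depth]
  linear_combination h0

theorem mul_coord_two_of_eigenvector (hu : reducedMatrix r *ᵥ u = (-l) • u) :
    l * u 2 = -(r * (r ^ 3 * excess r u + alpha r * depth r u)) := by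
  rw [reducedMatrix_mulVec, J_mulVec, P2_mulVec_eq] at hu
  have h2 := congrFun hu 2
  simp only [Matrix.cons_val, Pi.smul_apply, smul_eq_mul, P3_mulVec_P1_mulVec_zero] at h2
  rw [depth]
  linear_combination h2

theorem excess_add_depth_of_eigenvector (hu : reducedMatrix r *ᵥ u = (-l) • u) :
    r * ((alpha r ^ 2 * r ^ 3 + l) * excess r u + alpha r * (alpha r ^ 2 - r) * depth r u) =
      l * (alpha r ^ 2 - r) * u 0 := by
  have hw := mul_P3_mulVec_P1_mulVec_two_of_eigenvector hu
  rw [reducedMatrix_mulVec, J_mulVec, P2_mulVec_eq] at hu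
  have h1 := congrFun hu 1
  simp only [Matrix.cons_val, Pi.smul_apply, smul_eq_mul, P3_mulVec_P1_mulVec_zero] at h1
  have hd : (P3 r *ᵥ (P1 r *ᵥ u)) 1 = -depth r u := (neg_neg _).symm
  rw [hd] at h1
  have he : alpha r * u 1 = excess r u + u 0 := (sub_add_cancel _ _).symm
  linear_combination alpha r * r * h1 - alpha r ^ 2 * hw - r * l * he

theorem excess_eq_depth_mul_margin (hr : r ≠ 0) (hu : reducedMatrix r *ᵥ u = (-l) • u) :
    (l ^ 2 - r ^ 8) * excess r u = alpha r * depth r u * margin r l := by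
  have hK : (1 - 4 * r + r ^ 2) / 2 = 2 * alpha r ^ 2 - 3 * r := by
    unfold alpha
    ring
  rw [margin, hK]
  refine mul_left_cancel₀ hr ?_
  linear_combination l * excess_add_depth_of_eigenvector hu -
    r * l * mul_P3_mulVec_P1_mulVec_two r u +
    (alpha r ^ 2 - r) * l * mul_P3_mulVec_P1_mulVec_two_of_eigenvector hu -
    r ^ 5 * mul_coord_two_of_eigenvector hu

theorem eigenDet_mul_depth (hr : r ≠ 0) (hu : reducedMatrix r *ᵥ u = (-l) • u) :
    r * eigenDet r l * depth r u = l * (alpha r ^ 2 - r) * (l ^ 2 - r ^ 8) * u 0 := by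
  unfold eigenDet
  linear_combination (l ^ 2 - r ^ 8) * excess_add_depth_of_eigenvector hu -
    r * (alpha r ^ 2 * r ^ 3 + l) * excess_eq_depth_mul_margin hr hu

end Eigenvector

/-- The polynomial whose root in `]0,1[` is the critical restitution coefficient. -/
def critPoly (r : ℝ) : ℝ := 5 - 22 * r - 2 * r ^ 2 - 6 * r ^ 3 + r ^ 4

theorem strictAntiOn_critPoly : StrictAntiOn critPoly (Icc 0 1) := by
  intro a ⟨ha, _⟩ b ⟨_, hb⟩ hab
  have h2 : a ^ 2 < b ^ 2 := by gcongr
  have h3 : a ^ 3 < b ^ 3 := by gcongr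
  have h4 : b ^ 4 - a ^ 4 ≤ 4 * (b - a) := by
    nlinarith [mul_nonneg (sub_nonneg.2 hab.le) (sub_nonneg.2 hb),
      mul_nonneg (sub_nonneg.2 hab.le) ha]
  unfold critPoly
  linarith

theorem exists_critPoly_eq_zero : ∃ rc ∈ Ioo (0.22006978614631047520 : ℝ) 0.22006978614631047521,
    critPoly rc = 0 := by
  have hc : ContinuousOn critPoly (Icc 0.22006978614631047520 0.22006978614631047521) := by
    unfold critPoly
    fun_prop
  refine intermediate_value_Ioo' (by norm_num) hc ⟨?_, ?_⟩ <;> norm_num [critPoly]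

theorem margin_mul_cubicCofactor {r l : ℝ} (hl0 : l ≠ 0) (hl : reducedCubic r l = 0)
    (hK : (1 - 4 * r + r ^ 2) / 2 ≠ 0) :
    margin r l * (((1 - 4 * r + r ^ 2) / 2) ^ 2 *
      cubicCofactor (reducedTrace r) (r ^ 11) l (r ^ 5 / ((1 - 4 * r + r ^ 2) / 2))) =
      r ^ 10 * (1 - r) ^ 4 * (1 - 6 * r + r ^ 2) / 128 * critPoly r := by
  have hid : (r ^ 5) ^ 3 + reducedTrace r * ((1 - 4 * r + r ^ 2) / 2) * (r ^ 5) ^ 2 +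
      reducedMinorSum r * ((1 - 4 * r + r ^ 2) / 2) ^ 2 * r ^ 5 -
      ((1 - 4 * r + r ^ 2) / 2) ^ 3 * r ^ 11 =
      r ^ 10 * (1 - r) ^ 4 * (1 - 6 * r + r ^ 2) / 128 * critPoly r := by
    unfold reducedTrace reducedMinorSum critPoly
    ring
  rw [← hid, margin]
  generalize (1 - 4 * r + r ^ 2) / 2 = K at hK ⊢
  calc _ = K ^ 3 * ((r ^ 5 / K - l) * cubicCofactor (reducedTrace r) (r ^ 11) l (r ^ 5 / K)) := by
        field_simp
    _ = K ^ 3 * reducedCubic r (r ^ 5 / K) := by rw [reducedCubic, cubic_eq_mul hl0 hl]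
    _ = _ := by
        unfold reducedCubic cubic
        field_simp

namespace IsLargestRoot

variable {r l x : ℝ}

theorem cofactor_pos (h : IsLargestRoot r l) (hr : 11 / 50 < r) (hr1 : r < 1) (hx : 0 < x) :
    0 < cubicCofactor (reducedTrace r) (r ^ 11) l x := by
  have hr0 : 0 < r := by linarith
  exact cubicCofactor_pos (by positivity) (h.pos hr0 hr1)
    (add_pos_of_isGreatest (pow_add_reducedTrace_mul_pos hr hr1) h).le hx

theorem eq_of_pos (h : IsLargestRoot r l) (hr : 11 / 50 < r) (hr1 : r < 1) (hx : 0 < x)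
    (hx0 : reducedCubic r x = 0) : x = l := by
  rw [reducedCubic, cubic_eq_mul (h.pos (by linarith) hr1).ne' h.1, mul_eq_zero] at hx0
  exact sub_eq_zero.1 (hx0.resolve_right (h.cofactor_pos hr hr1 hx).ne')

theorem critPoly_eq_zero (h : IsLargestRoot r l) (hr0 : 0 < r) (hr1 : r < 1)
    (hm : margin r l = 0) : critPoly r = 0 := by
  have hKl : (1 - 4 * r + r ^ 2) / 2 * l = r ^ 5 := by
    unfold margin at hm
    linarith
  have hl := h.pos hr0 hr1
  have hK0 : 0 < (1 - 4 * r + r ^ 2) / 2 :=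
    pos_of_mul_pos_left (by rw [hKl]; positivity) hl.le
  have hKr : (1 - 4 * r + r ^ 2) / 2 < r := by
    refine lt_of_mul_lt_mul_right ?_ hl.le
    rw [hKl, pow_succ']
    exact mul_lt_mul_of_pos_left (h.pow_lt hr0 hr1) hr0
  have key := margin_mul_cubicCofactor hl.ne' h.1 hK0.ne'
  rw [hm, zero_mul] at key
  refine (mul_eq_zero.1 key.symm).resolve_left (div_ne_zero (mul_ne_zero ?_ ?_) (by norm_num))
  · have : 0 < 1 - r := by linarith
    positivity
  · linarith

theorem margin_eq_zero (h : IsLargestRoot r l) (hr : 11 / 50 < r) (hr1 : r < 1)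
    (hc : critPoly r = 0) : margin r l = 0 := by
  have hr0 : 0 < r := by linarith
  have hr2 : r < 5 / 22 := by
    unfold critPoly at hc
    nlinarith [pow_pos hr0 3, pow_pos hr0 2]
  have hK : 0 < (1 - 4 * r + r ^ 2) / 2 := by nlinarith
  have key := margin_mul_cubicCofactor (h.pos hr0 hr1).ne' h.1 hK.ne'
  rw [hc, mul_zero] at key
  have hf := h.cofactor_pos hr hr1 (x := r ^ 5 / ((1 - 4 * r + r ^ 2) / 2)) (by positivity)
  exact (mul_eq_zero.1 key).resolve_right (by positivity)

theorem margin_pos (h : IsLargestRoot r l) (hr : 11 / 50 < r) (hr1 : r < 1)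
    (hc : critPoly r < 0) : 0 < margin r l := by
  have hr0 : 0 < r := by linarith
  have hl := h.pos hr0 hr1
  rcases le_or_gt ((1 - 4 * r + r ^ 2) / 2) 0 with hK | hK
  · have : (1 - 4 * r + r ^ 2) / 2 * l ≤ 0 := mul_nonpos_of_nonpos_of_nonneg hK hl.le
    have : 0 < r ^ 5 := by positivity
    unfold margin
    linarith
  have key := margin_mul_cubicCofactor hl.ne' h.1 hK.ne'
  have hf := h.cofactor_pos hr hr1 (x := r ^ 5 / ((1 - 4 * r + r ^ 2) / 2)) (by positivity)
  refine pos_of_mul_pos_left (b := _) ?_ (mul_pos (pow_pos hK 2) hf).le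
  rw [key]
  have h6 : 1 - 6 * r + r ^ 2 < 0 := by nlinarith
  have : 0 < (1 - r) ^ 4 := pow_pos (by linarith) 4
  exact mul_pos_of_neg_of_neg (div_neg_of_neg_of_pos (mul_neg_of_pos_of_neg (by positivity) h6)
    (by norm_num)) hc

theorem sq_sub_pow_pos (h : IsLargestRoot r l) (hr0 : 0 < r) (hr1 : r < 1) : 0 < l ^ 2 - r ^ 8 := by
  have : (r ^ 4) ^ 2 < l ^ 2 := by
    have := h.pow_lt hr0 hr1
    gcongr
  linarith

theorem eigenDet_pos (h : IsLargestRoot r l) (hr0 : 0 < r) (hr1 : r < 1) (hm : 0 ≤ margin r l) :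
    0 < eigenDet r l := by
  have hα := alpha_pos hr0
  have hδ : 0 < alpha r ^ 2 - r := by
    rw [alpha_sq_sub]
    have : 0 < 1 - r := by linarith
    positivity
  have hs := h.sq_sub_pow_pos hr0 hr1
  have hl := h.pos hr0 hr1
  unfold eigenDet
  positivity

end IsLargestRoot

theorem isRoot_charpoly_iff {n R : Type*} [Fintype n] [DecidableEq n] [CommRing R] [IsDomain R]
    {M : Matrix n n R} {m : R} : M.charpoly.IsRoot m ↔ ∃ v ≠ 0, M *ᵥ v = m • v := by
  rw [Polynomial.IsRoot, Matrix.eval_charpoly, ← Matrix.exists_mulVec_eq_zero_iff]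
  refine exists_congr fun v => and_congr_right fun _ => ?_
  rw [Matrix.sub_mulVec, sub_eq_zero, Matrix.scalar_apply, ← Matrix.smul_one_eq_diagonal,
    Matrix.smul_mulVec, Matrix.one_mulVec, eq_comm]

namespace IsLargestRoot

variable {r l : ℝ} {u v : Vec}

theorem eq_zero_of_eigenvector (h : IsLargestRoot r l) (hr0 : 0 < r) (hr1 : r < 1)
    (hm : 0 ≤ margin r l) (hu : reducedMatrix r *ᵥ u = (-l) • u) (h0 : u 0 = 0) : u = 0 := by
  have hB : depth r u = 0 := by
    have := eigenDet_mul_depth hr0.ne' hu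
    rw [h0, mul_zero] at this
    exact (mul_eq_zero.1 this).resolve_left (mul_pos hr0 (h.eigenDet_pos hr0 hr1 hm)).ne'
  have hA : excess r u = 0 := by
    have := excess_eq_depth_mul_margin hr0.ne' hu
    rw [hB, mul_zero, zero_mul] at this
    exact (mul_eq_zero.1 this).resolve_left (h.sq_sub_pow_pos hr0 hr1).ne'
  have h1 : u 1 = 0 := by
    rw [excess, h0, sub_zero] at hA
    exact (mul_eq_zero.1 hA).resolve_left (alpha_pos hr0).ne'
  have h2 : u 2 = 0 := by
    have := mul_coord_two_of_eigenvector hu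
    rw [hA, hB] at this
    simpa [(h.pos hr0 hr1).ne'] using this
  ext i
  fin_cases i <;> assumption

theorem eigenvector_eq (h : IsLargestRoot r l) (hr0 : 0 < r) (hr1 : r < 1) (hm : 0 ≤ margin r l)
    (hu : reducedMatrix r *ᵥ u = (-l) • u) (h0 : u 0 = 1)
    (hv : reducedMatrix r *ᵥ v = (-l) • v) : v = v 0 • u := by
  rw [← sub_eq_zero]
  refine h.eq_zero_of_eigenvector hr0 hr1 hm ?_ (by simp [h0])
  rw [Matrix.mulVec_sub, Matrix.mulVec_smul, hu, hv, smul_sub, smul_comm]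

theorem exists_eigenvector (h : IsLargestRoot r l) (hr0 : 0 < r) (hr1 : r < 1)
    (hm : 0 ≤ margin r l) : ∃ u : Vec, reducedMatrix r *ᵥ u = (-l) • u ∧ u 0 = 1 := by
  obtain ⟨v, hv0, hv⟩ := isRoot_charpoly_iff.1 (isRoot_charpoly_reducedMatrix_neg.2 h.1)
  have h0 : v 0 ≠ 0 := fun h0 => hv0 (h.eq_zero_of_eigenvector hr0 hr1 hm hv h0)
  refine ⟨(v 0)⁻¹ • v, ?_, by simp [h0]⟩
  rw [Matrix.mulVec_smul, hv, smul_comm]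

theorem isDominatingEigenvector_iff (h : IsLargestRoot r l) (hr0 : 0 < r) (hr1 : r < 1) :
    IsDominatingEigenvector (reducedMatrix r) u ↔
      reducedMatrix r *ᵥ u = (-l) • u ∧ u 0 = 1 := by
  have hd := h.isDominatingEigenvalue hr0 hr1
  refine and_congr_left' ⟨?_, fun hu => ⟨_, hd, hu⟩⟩
  rintro ⟨m, hm, hu⟩
  rwa [hd.unique hm] at hu

theorem margin_eq_zero_of_eigenvector (h : IsLargestRoot r l) (hr0 : 0 < r) (hr1 : r < 1)
    (hu : reducedMatrix r *ᵥ u = (-l) • u) (h0 : u 0 = 1) (hA : excess r u = 0) :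
    margin r l = 0 := by
  have hB : depth r u ≠ 0 := by
    intro hB
    have hδ : l * (alpha r ^ 2 - r) = 0 := by
      simpa [hA, hB, h0] using (excess_add_depth_of_eigenvector hu).symm
    rw [alpha_sq_sub] at hδ
    have : 0 < 1 - r := by linarith
    have := h.pos hr0 hr1
    exact absurd hδ (by positivity)
  have := excess_eq_depth_mul_margin hr0.ne' hu
  rw [hA, mul_zero] at this
  exact (mul_eq_zero.1 this.symm).resolve_left (mul_ne_zero (alpha_pos hr0).ne' hB)

end IsLargestRoot

theorem exists_dominatingEigenvector_excess_eq_zero_iff {r : ℝ} (hr0 : 0 < r) (hr1 : r < 1) :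
    (∃ u : Vec, IsDominatingEigenvector (reducedMatrix r) u ∧ excess r u = 0) ↔
      critPoly r = 0 := by
  obtain ⟨l, h⟩ := exists_isLargestRoot hr0 hr1
  simp only [h.isDominatingEigenvector_iff hr0 hr1]
  constructor
  · rintro ⟨u, ⟨hu, h0⟩, hA⟩
    exact h.critPoly_eq_zero hr0 hr1 (h.margin_eq_zero_of_eigenvector hr0 hr1 hu h0 hA)
  · intro hc
    have hr : 11 / 50 < r := by
      by_contra! hr
      have hpos : 0 < critPoly (11 / 50) := by norm_num [critPoly]
      exact (hpos.trans_le (strictAntiOn_critPoly.antitoneOn ⟨hr0.le, hr1.le⟩ (by norm_num) hr)).ne'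
        hc
    have hm := h.margin_eq_zero hr hr1 hc
    obtain ⟨u, hu, h0⟩ := h.exists_eigenvector hr0 hr1 hm.ge
    have hA := excess_eq_depth_mul_margin hr0.ne' hu
    rw [hm, mul_zero] at hA
    exact ⟨u, ⟨hu, h0⟩, (mul_eq_zero.1 hA).resolve_left (h.sq_sub_pow_pos hr0 hr1).ne'⟩

section PowerConvergence

open scoped ENNReal NNReal

theorem tendsto_pow_of_spectralRadius_lt_one {A : Type*} [NormedRing A] [NormedAlgebra ℂ A]
    [CompleteSpace A] {a : A} (ha : spectralRadius ℂ a < 1) :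
    Tendsto (fun n : ℕ => a ^ n) atTop (𝓝 0) := by
  obtain ⟨c, hac, hc1⟩ := ENNReal.lt_iff_exists_nnreal_btwn.1 ha
  have hpow : ∀ᶠ n : ℕ in atTop, ‖a ^ n‖ ≤ (c : ℝ) ^ n := by
    have hgelfand := spectrum.pow_nnnorm_pow_one_div_tendsto_nhds_spectralRadius a
    filter_upwards [hgelfand.eventually_lt_const hac, eventually_ge_atTop 1] with n hn hn1
    have hn0 : (0 : ℝ) < n := by exact_mod_cast hn1
    rw [one_div, ENNReal.rpow_inv_lt_iff hn0, ENNReal.rpow_natCast] at hn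
    exact_mod_cast hn.le
  exact squeeze_zero_norm' hpow
    (tendsto_pow_atTop_nhds_zero_of_lt_one c.2 (by exact_mod_cast hc1))

open scoped Matrix.Norms.Operator in
theorem tendsto_pow_of_forall_mem_spectrum_norm_lt_one {n : Type*} [Fintype n] [DecidableEq n]
    {M : Matrix n n ℂ} (hM : ∀ m ∈ spectrum ℂ M, ‖m‖ < 1) :
    Tendsto (fun k : ℕ => M ^ k) atTop (𝓝 0) := by
  nontriviality Matrix n n ℂ
  exact tendsto_pow_of_spectralRadius_lt_one (spectrum.spectralRadius_lt_of_forall_lt M hM)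

open Polynomial in
theorem tendsto_pow_aeval_of_forall_root {n : Type*} [Fintype n] [DecidableEq n]
    {M : Matrix n n ℝ} {p : ℝ[X]} (hp : ∀ m : ℂ, aeval m M.charpoly = 0 → ‖aeval m p‖ < 1) :
    Tendsto (fun k : ℕ => aeval M p ^ k) atTop (𝓝 0) := by
  set φ := (Algebra.ofId ℝ ℂ).mapMatrix (m := n)
  have hφ : φ (aeval M p) = aeval (φ M) (p.map (algebraMap ℝ ℂ)) := by
    rw [aeval_map_algebraMap, aeval_algHom_apply]
  have hlim : Tendsto (fun k : ℕ => φ (aeval M p) ^ k) atTop (𝓝 0) := by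
    nontriviality Matrix n n ℂ
    refine tendsto_pow_of_forall_mem_spectrum_norm_lt_one ?_
    rw [hφ, spectrum.map_polynomial_aeval_of_nonempty _ _
      (spectrum.nonempty_of_isAlgClosed_of_finiteDimensional ℂ _)]
    rintro _ ⟨m, hm, rfl⟩
    rw [Matrix.mem_spectrum_iff_isRoot_charpoly] at hm
    have hchar : (φ M).charpoly = M.charpoly.map (algebraMap ℝ ℂ) := M.charpoly_map _
    rw [hchar, IsRoot, eval_map_algebraMap] at hm
    simpa only [eval_map_algebraMap] using hp m hm
  have hre : ∀ N : Matrix n n ℝ, (φ N).map Complex.re = N := fun N => by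
    ext i j
    exact Complex.ofReal_re _
  have := ((continuous_id.matrix_map Complex.continuous_re).tendsto _).comp hlim
  simpa only [Function.comp_def, id, ← map_pow, ← map_zero φ, hre] using this

theorem pow_succ_eq_add_sub_pow {R : Type*} [Ring R] {a e : R} (hae : a * e = e) (hea : e * a = e)
    (hee : e * e = e) (n : ℕ) : a ^ (n + 1) = e + (a - e) ^ (n + 1) := by
  induction n with
  | zero => simp
  | succ n ih =>
    have h : (a - e) * e = 0 := by rw [sub_mul, hae, hee, sub_self]
    rw [pow_succ, ih, pow_succ _ (n + 1), mul_sub, add_mul, hea]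
    rw [pow_succ _ n, mul_assoc _ _ e, h, mul_zero, sub_zero]

open Polynomial in
theorem aeval_mul_aeval_eq_eval_smul {R A : Type*} [CommRing R] [Ring A] [Algebra R A] {a : A}
    {l : R} {g : R[X]} (h : aeval a ((X - C l) * g) = 0) (q : R[X]) :
    aeval a q * aeval a g = q.eval l • aeval a g := by
  obtain ⟨k, hk⟩ := X_sub_C_dvd_sub_C_eval (p := q) (a := l)
  rw [← sub_eq_zero, Algebra.smul_def, ← aeval_C, ← sub_mul, ← map_sub, ← map_mul, hk,
    mul_right_comm, map_mul, h, zero_mul]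

open Polynomial in
theorem IsDominatingEigenvalue.exists_charpoly_eq_mul {M : Matrix (Fin 3) (Fin 3) ℝ} {l : ℝ}
    (h : IsDominatingEigenvalue M l) : ∃ g, M.charpoly = (X - C l) * g ∧ g.eval l ≠ 0 := by
  have hfac := M.charpoly.pow_mul_divByMonic_rootMultiplicity_eq l
  have hne := eval_divByMonic_pow_rootMultiplicity_ne_zero l M.charpoly_monic.ne_zero
  rw [h.1, pow_one] at hfac hne
  exact ⟨_, hfac.symm, hne⟩

open Polynomial in
theorem IsDominatingEigenvalue.norm_aeval_sub_lt_one {M : Matrix (Fin 3) (Fin 3) ℝ} {l : ℝ}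
    (h : IsDominatingEigenvalue M l) (hl : l ≠ 0) {g : ℝ[X]} (hg : M.charpoly = (X - C l) * g)
    (hgl : g.eval l ≠ 0) {m : ℂ} (hm : aeval m M.charpoly = 0) :
    ‖aeval m (C l⁻¹ * X - C (g.eval l)⁻¹ * g)‖ < 1 := by
  by_cases hml : m = algebraMap ℝ ℂ l
  · rw [hml, aeval_algebraMap_apply_eq_algebraMap_eval]
    simp [hl, hgl]
  · have hgm : aeval m g = 0 := by
      rw [hg, map_mul, map_sub, aeval_X, aeval_C] at hm
      exact (mul_eq_zero.1 hm).resolve_left (sub_ne_zero.2 hml)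
    simpa [hgm, inv_mul_lt_one₀ (abs_pos.2 hl)] using h.2 m hm hml

open Polynomial in
/-- The limit is the spectral projection `g(l)⁻¹ g(M)`, where `(X - l) g` is the characteristic
polynomial. -/
theorem IsDominatingEigenvalue.exists_tendsto_pow {M : Matrix (Fin 3) (Fin 3) ℝ} {l : ℝ}
    (h : IsDominatingEigenvalue M l) (hl : l ≠ 0) :
    ∃ E, Tendsto (fun n : ℕ => (l⁻¹ • M) ^ n) atTop (𝓝 E) ∧ M * E = l • E := by
  obtain ⟨g, hg, hgl⟩ := h.exists_charpoly_eq_mul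
  set E := aeval M (C (g.eval l)⁻¹ * g) with hE
  have hqE : ∀ q : ℝ[X], aeval M q * E = q.eval l • E := by
    intro q
    rw [hE, map_mul, ← mul_assoc, ← map_mul, mul_comm q, map_mul, mul_assoc,
      aeval_mul_aeval_eq_eval_smul (hg ▸ M.aeval_self_charpoly), mul_smul_comm]
  set T := aeval M (C l⁻¹ * X) with hT
  have hTE : T * E = E := by
    rw [hT, hqE]
    simp [hl]
  have hET : E * T = E := by
    conv_rhs => rw [← hTE]
    rw [hE, hT, ← map_mul, ← map_mul, mul_comm]
  have hEE : E * E = E := by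
    nth_rewrite 1 [hE]
    rw [hqE]
    simp [hgl]
  have hlim : Tendsto (fun n : ℕ => (T - E) ^ n) atTop (𝓝 0) := by
    rw [hT, hE, ← map_sub]
    exact tendsto_pow_aeval_of_forall_root fun m hm => h.norm_aeval_sub_lt_one hl hg hgl hm
  refine ⟨E, ?_, by simpa using hqE X⟩
  have hTM : l⁻¹ • M = T := by simp [hT, Algebra.smul_def]
  rw [← tendsto_add_atTop_iff_nat 1, hTM]
  simp only [pow_succ_eq_add_sub_pow hTE hET hEE]
  simpa using ((tendsto_add_atTop_iff_nat 1).2 hlim).const_add E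

end PowerConvergence

theorem IsDominatingEigenvalue.mulVec_eq_smul {M : Matrix (Fin 3) (Fin 3) ℝ} {l : ℝ}
    (h : IsDominatingEigenvalue M l) (hl : l ≠ 0) {v : Vec} (hv : M *ᵥ (M *ᵥ v) = l ^ 2 • v) :
    M *ᵥ v = l • v := by
  by_contra hne
  have heig : M *ᵥ (M *ᵥ v - l • v) = (-l) • (M *ᵥ v - l • v) := by
    rw [Matrix.mulVec_sub, Matrix.mulVec_smul, hv]
    module
  have hroot := isRoot_charpoly_iff.2 ⟨_, sub_ne_zero.2 hne, heig⟩
  have := h.abs_lt hroot (neg_ne_self.2 hl)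
  rw [abs_neg] at this
  exact lt_irrefl _ this

section Sphere

theorem norm2_sq (u : Vec) : norm2 u ^ 2 = u 0 ^ 2 + u 1 ^ 2 + u 2 ^ 2 := by
  have hdot : u ⬝ᵥ u = u 0 ^ 2 + u 1 ^ 2 + u 2 ^ 2 := by
    rw [dotProduct, Fin.sum_univ_three]
    ring
  rw [norm2, hdot, Real.sq_sqrt (by positivity)]

theorem norm2_eq_norm_toLp (u : Vec) : norm2 u = ‖WithLp.toLp 2 u‖ := by
  rw [EuclideanSpace.norm_eq, norm2, dotProduct]
  simp only [Real.norm_eq_abs, pow_two, abs_mul_abs_self]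

theorem norm2_pos {u : Vec} (hu : u ≠ 0) : 0 < norm2 u := by
  rw [norm2_eq_norm_toLp, norm_pos_iff]
  simpa using hu

theorem continuous_norm2 : Continuous norm2 := by
  unfold norm2
  fun_prop

theorem norm_le_norm2 (u : Vec) : ‖u‖ ≤ norm2 u := by
  rw [norm2_eq_norm_toLp]
  exact (pi_norm_le_iff_of_nonneg (norm_nonneg _)).2 fun i =>
    PiLp.norm_apply_le (WithLp.toLp 2 u) i

theorem continuousAt_toSphere {u : Vec} (hu : u ≠ 0) : ContinuousAt toSphere u :=
  (continuous_norm2.continuousAt.inv₀ (norm2_pos hu).ne').smul continuousAt_id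

theorem exists_pos_toSphere_eq_smul (u : Vec) : ∃ c : ℝ, 0 < c ∧ toSphere u = c • u := by
  obtain rfl | hu := eq_or_ne u 0
  · exact ⟨1, one_pos, by simp [toSphere]⟩
  · exact ⟨_, inv_pos.2 (norm2_pos hu), rfl⟩

theorem toSphere_mulVec_toSphere (A : Matrix (Fin 3) (Fin 3) ℝ) (u : Vec) :
    toSphere (A *ᵥ toSphere u) = toSphere (A *ᵥ u) := by
  obtain ⟨c, hc, h⟩ := exists_pos_toSphere_eq_smul u
  rw [h, Matrix.mulVec_smul, toSphere_smul hc]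

theorem toSphere_toSphere (u : Vec) : toSphere (toSphere u) = toSphere u := by
  obtain ⟨c, hc, h⟩ := exists_pos_toSphere_eq_smul u
  rw [h, toSphere_smul hc, h]

theorem norm2_toSphere {u : Vec} (hu : u ≠ 0) : norm2 (toSphere u) = 1 := by
  have h := norm_smul_inv_norm (𝕜 := ℝ) (x := WithLp.toLp 2 u) (by simpa using hu)
  rw [norm2_eq_norm_toLp, toSphere, norm2_eq_norm_toLp]
  exact h

theorem toSphere_eq_self_of_mem_domX {u : Vec} (hu : u ∈ domX) : toSphere u = u := by
  have hnorm : norm2 u = 1 := by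
    refine (pow_eq_one_iff_of_nonneg (Real.sqrt_nonneg _) two_ne_zero).1 ?_
    exact (norm2_sq u).trans hu.1
  rw [toSphere, hnorm, inv_one, one_smul]

end Sphere

section Quadrant

/-- The quadrant `x ≥ 0, z ≤ 0` of the representatives chosen by `orient`. -/
def quadrant : Set Vec := {w | 0 ≤ w 0 ∧ w 2 ≤ 0}

theorem smul_mem_quadrant_iff {c : ℝ} (hc : 0 < c) {w : Vec} :
    c • w ∈ quadrant ↔ w ∈ quadrant := by
  simp only [quadrant, mem_ofPred_eq, ← not_lt, Pi.smul_apply, smul_neg_iff_of_pos_left hc,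
    smul_pos_iff_of_pos_left hc]

theorem toSphere_mem_quadrant_iff {w : Vec} : toSphere w ∈ quadrant ↔ w ∈ quadrant := by
  obtain ⟨c, hc, h⟩ := exists_pos_toSphere_eq_smul w
  rw [h, smul_mem_quadrant_iff hc]

theorem toSphere_mem_domX {w : Vec} (hw : w ∈ quadrant) (h0 : w ≠ 0) : toSphere w ∈ domX := by
  refine ⟨?_, Or.inl (toSphere_mem_quadrant_iff.2 hw)⟩
  rw [← norm2_sq, norm2_toSphere h0, one_pow]

theorem orient_of_mem_quadrant {w : Vec} (hw : w ∈ quadrant) : orient w = w :=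
  if_pos hw

theorem orient_mem_quadrant {v : Vec} (hv : v ∈ domX) : orient v ∈ quadrant := by
  unfold orient
  split_ifs with h
  · exact h
  · obtain ⟨h0, h2⟩ := hv.2.resolve_left h
    exact ⟨neg_nonneg.2 h0, neg_nonpos.2 h2⟩

theorem orient_ne_zero {v : Vec} (hv : v ∈ domX) : orient v ≠ 0 := by
  have hv0 : v ≠ 0 := by
    rintro rfl
    simpa using hv.1
  unfold orient
  split_ifs
  · exact hv0
  · exact neg_ne_zero.2 hv0

theorem orient_smul {c : ℝ} (hc : 0 < c) (w : Vec) : orient (c • w) = c • orient w := by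
  have h := smul_mem_quadrant_iff hc (w := w)
  unfold orient
  split_ifs with hcw hw hw
  · rfl
  · exact absurd (h.1 hcw) hw
  · exact absurd (h.2 hw) hcw
  · rw [smul_neg]

theorem letter_smul (r : ℝ) {c : ℝ} (hc : 0 < c) (w : Vec) :
    letter r (c • w) = letter r w := by
  simp only [letter, Pi.smul_apply, mul_smul_comm, ← smul_sub, smul_pos_iff_of_pos_left hc,
    smul_neg_iff_of_pos_left hc]

theorem code_toSphere (r : ℝ) (w : Vec) : code r (toSphere w) = code r w := by
  obtain ⟨c, hc, h⟩ := exists_pos_toSphere_eq_smul w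
  rw [h, code, code, orient_smul hc, letter_smul r hc]

theorem bMap_toSphere (r : ℝ) (w : Vec) : bMap r (toSphere w) = bMap r w := by
  rw [bMap, bMap, code_toSphere]
  obtain ⟨c, hc, h⟩ := exists_pos_toSphere_eq_smul w
  rw [h, orient_smul hc, Matrix.mulVec_smul, toSphere_smul hc]

theorem code_of_mem_quadrant {w : Vec} (r : ℝ) (hw : w ∈ quadrant) : code r w = letter r w := by
  rw [code, orient_of_mem_quadrant hw]

theorem bMap_of_mem_quadrant {w : Vec} (r : ℝ) (hw : w ∈ quadrant) :
    bMap r w = toSphere ((letter r w).matrix r *ᵥ w) := by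
  rw [bMap, code_of_mem_quadrant r hw, orient_of_mem_quadrant hw]

theorem isUnit_matrix {r : ℝ} (hr : r ≠ 0) (s : Block) : IsUnit (s.matrix r) := by
  have hdet : (s.matrix r).det = r ^ 4 ∨ (s.matrix r).det = r ^ 3 := by
    cases s
    · left
      simp [Block.matrix, P1, Matrix.det_fin_three]
      ring
    · right
      simp [Block.matrix, P2, Matrix.det_fin_three]
      ring
    · left
      simp [Block.matrix, P3, Matrix.det_fin_three]
      ring
  rw [Matrix.isUnit_iff_isUnit_det, isUnit_iff_ne_zero]
  rcases hdet with h | h <;> simp [h, hr]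

theorem letter_matrix_mulVec_mem_quadrant {r : ℝ} (hr : 0 < r) {w : Vec} (hw : w ∈ quadrant) :
    (letter r w).matrix r *ᵥ w ∈ quadrant := by
  have ha := alpha_pos hr
  obtain ⟨hx, hz⟩ := hw
  unfold letter
  split_ifs with h1 h3
  · rw [Block.matrix, P1_mulVec_eq]
    exact ⟨(mul_pos hr h1.2).le, mul_nonpos_of_nonneg_of_nonpos (sq_nonneg r) hz⟩
  · rw [Block.matrix, P3_mulVec_eq]
    exact ⟨mul_nonneg (sq_nonneg r) hx, (mul_neg_of_pos_of_neg hr h3.2).le⟩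
  · have hx' : alpha r * w 1 - w 0 ≤ 0 := by
      rcases le_or_gt (w 1) 0 with h | h
      · nlinarith
      · exact not_lt.1 fun h' => h1 ⟨h, h'⟩
    have hz' : 0 ≤ alpha r * w 1 - w 2 := by
      rcases le_or_gt 0 (w 1) with h | h
      · nlinarith
      · exact not_lt.1 fun h' => h3 ⟨h, h'⟩
    rw [Block.matrix, P2_mulVec_eq]
    exact ⟨neg_nonneg.2 (mul_nonpos_of_nonneg_of_nonpos hr.le hx'),
      neg_nonpos.2 (mul_nonneg hr.le hz')⟩

theorem mapsTo_bMap {r : ℝ} (hr : 0 < r) : MapsTo (bMap r) domX (domX ∩ quadrant) := by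
  intro v hv
  have hq := letter_matrix_mulVec_mem_quadrant hr (orient_mem_quadrant hv)
  have hinj := Matrix.mulVec_injective_of_isUnit (isUnit_matrix hr.ne' (code r v))
  have h0 : (code r v).matrix r *ᵥ orient v ≠ 0 := fun h =>
    orient_ne_zero hv (hinj (h.trans (Matrix.mulVec_zero _).symm))
  exact ⟨toSphere_mem_domX hq h0, toSphere_mem_quadrant_iff.2 hq⟩

end Quadrant

section Itinerary

/-- The cone of the vectors of the quadrant with a given letter. -/
def sector (r : ℝ) (s : Block) : Set Vec := {w ∈ quadrant | letter r w = s}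

theorem bMap_of_mem_sector {r : ℝ} {s : Block} {w : Vec} (hw : w ∈ sector r s) :
    bMap r w = toSphere (s.matrix r *ᵥ w) := by
  rw [bMap_of_mem_quadrant r hw.1, hw.2]

theorem toSphere_mem_sector_iff {r : ℝ} {s : Block} {w : Vec} :
    toSphere w ∈ sector r s ↔ w ∈ sector r s := by
  obtain ⟨c, hc, h⟩ := exists_pos_toSphere_eq_smul w
  simp only [sector, mem_ofPred_eq, h, smul_mem_quadrant_iff hc, letter_smul r hc]

/-- The product of the matrices of the first `n` letters of a word, latest letter on the left. -/
noncomputable def prefixProd (r : ℝ) (s : ℕ → Block) : ℕ → Matrix (Fin 3) (Fin 3) ℝ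
  | 0 => 1
  | n + 1 => (s n).matrix r * prefixProd r s n

theorem prefixProd_zero_mulVec (r : ℝ) (s : ℕ → Block) (w : Vec) :
    prefixProd r s 0 *ᵥ w = w :=
  Matrix.one_mulVec w

theorem prefixProd_succ_mulVec (r : ℝ) (s : ℕ → Block) (n : ℕ) (w : Vec) :
    prefixProd r s (n + 1) *ᵥ w = (s n).matrix r *ᵥ (prefixProd r s n *ᵥ w) :=
  (Matrix.mulVec_mulVec _ _ _).symm

theorem iterate_bMap_toSphere {r : ℝ} {s : ℕ → Block} {w : Vec} {n : ℕ}
    (hw : ∀ k < n, prefixProd r s k *ᵥ w ∈ sector r (s k)) :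
    (bMap r)^[n] (toSphere w) = toSphere (prefixProd r s n *ᵥ w) := by
  induction n with
  | zero => rw [Function.iterate_zero_apply, prefixProd_zero_mulVec]
  | succ n ih =>
    rw [Function.iterate_succ_apply', ih fun k hk => hw k (by lia), bMap_toSphere,
      bMap_of_mem_sector (hw n (by lia)), prefixProd_succ_mulVec]

theorem iterate_succ_bMap_toSphere (r : ℝ) (n : ℕ) (w : Vec) :
    (bMap r)^[n + 1] (toSphere w) = (bMap r)^[n + 1] w := by
  rw [Function.iterate_succ_apply, Function.iterate_succ_apply, bMap_toSphere]

/-- The open cones on which the collisions denoted by a letter occur without degeneracy. -/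
def cell (r : ℝ) : Block → Set Vec
  | .one => {w | (0 < w 0 ∧ w 2 < 0) ∧ 0 < w 1 ∧ 0 < alpha r * w 1 - w 0}
  | .two => {w | (0 < w 0 ∧ w 2 < 0) ∧ w 1 ≠ 0 ∧ alpha r * w 1 - w 0 < 0 ∧
      0 < alpha r * w 1 - w 2}
  | .three => {w | (0 < w 0 ∧ w 2 < 0) ∧ w 1 < 0 ∧ alpha r * w 1 - w 2 < 0}

theorem isOpen_cell (r : ℝ) (s : Block) : IsOpen (cell r s) := by
  have hquadrant : IsOpen {w : Vec | 0 < w 0 ∧ w 2 < 0} :=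
    (isOpen_lt (by fun_prop) (by fun_prop)).and (isOpen_lt (by fun_prop) (by fun_prop))
  cases s
  · exact hquadrant.and
      ((isOpen_lt (by fun_prop) (by fun_prop)).and (isOpen_lt (by fun_prop) (by fun_prop)))
  · exact hquadrant.and ((isOpen_ne_fun (by fun_prop) (by fun_prop)).and
      ((isOpen_lt (by fun_prop) (by fun_prop)).and (isOpen_lt (by fun_prop) (by fun_prop))))
  · exact hquadrant.and
      ((isOpen_lt (by fun_prop) (by fun_prop)).and (isOpen_lt (by fun_prop) (by fun_prop)))

theorem pos_of_mem_cell {r : ℝ} {s : Block} {w : Vec} (hw : w ∈ cell r s) :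
    0 < w 0 ∧ w 2 < 0 := by
  cases s <;> exact hw.1

theorem ne_zero_of_mem_cell {r : ℝ} {s : Block} {w : Vec} (hw : w ∈ cell r s) : w ≠ 0 := by
  rintro rfl
  exact lt_irrefl _ (pos_of_mem_cell hw).1

theorem cell_subset_sector (r : ℝ) (s : Block) : cell r s ⊆ sector r s := by
  intro w hw
  refine ⟨⟨(pos_of_mem_cell hw).1.le, (pos_of_mem_cell hw).2.le⟩, ?_⟩
  cases s
  · exact if_pos hw.2
  · obtain ⟨-, -, h1, h2⟩ := hw
    rw [letter, if_neg fun h => lt_asymm h.2 h1, if_neg fun h => lt_asymm h.2 h2]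
  · obtain ⟨-, h1, h2⟩ := hw
    rw [letter, if_neg fun h => lt_asymm h.1 h1, if_pos ⟨h1, h2⟩]

theorem smul_mem_cell_iff {r : ℝ} {s : Block} {c : ℝ} (hc : 0 < c) {w : Vec} :
    c • w ∈ cell r s ↔ w ∈ cell r s := by
  cases s <;>
    simp only [cell, mem_ofPred_eq, Pi.smul_apply, mul_smul_comm, ← smul_sub,
      smul_pos_iff_of_pos_left hc, smul_neg_iff_of_pos_left hc, smul_ne_zero_iff_right hc.ne']

theorem toSphere_mem_cell_iff {r : ℝ} {s : Block} {w : Vec} :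
    toSphere w ∈ cell r s ↔ w ∈ cell r s := by
  obtain ⟨c, hc, h⟩ := exists_pos_toSphere_eq_smul w
  rw [h, smul_mem_cell_iff hc]

theorem exists_bToB_eq_of_mem_cell {r : ℝ} (hr : 0 < r) {s : Block} {w : Vec}
    (hw : w ∈ cell r s) (hX : w ∈ domX) :
    ∃ c ∈ s.words, ∃ u' : Vec, bToB r w = some (c, u') ∧ toSphere u' = bMap r w := by
  have := alpha_pos hr
  obtain ⟨hx, hz⟩ := pos_of_mem_cell hw
  have hs : s = code r w := by
    rw [code_of_mem_quadrant r (cell_subset_sector r s hw).1, (cell_subset_sector r s hw).2]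
  rw [hs]
  suffices w 1 ≠ 0 ∧ alpha r * w 1 - w 0 ≠ 0 ∧ alpha r * w 1 - w 2 ≠ 0 from
    bMap_eq_collisions hr hX hx.ne' this.1 hz.ne this.2.1 this.2.2
  clear hs
  cases s
  · obtain ⟨-, hy, hxy⟩ := hw
    exact ⟨hy.ne', hxy.ne', by nlinarith⟩
  · exact ⟨hw.2.1, hw.2.2.1.ne, hw.2.2.2.ne'⟩
  · obtain ⟨-, hy, hzy⟩ := hw
    exact ⟨hy.ne, by nlinarith, hzy.ne⟩

end Itinerary

section Word

/-- The periodic word `132312132312…`. -/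
def word (n : ℕ) : Block := pattern132312 (Fin.ofNat 6 n)

theorem word_fin (k : Fin 6) : word k = pattern132312 k := by
  rw [word, Fin.ofNat_val_eq_self]

/-- The exchange of the letters `1` and `3`, the effect on words of the reflection `J`. -/
def mirror : Block → Block
  | .one => .three
  | .two => .two
  | .three => .one

theorem mirror_matrix_mul_J (r : ℝ) (s : Block) : (mirror s).matrix r * J = J * s.matrix r := by
  ext i j
  cases s <;> fin_cases i <;> fin_cases j <;>
    simp [mirror, Block.matrix, J, P1, P2, P3, Matrix.mul_apply, Fin.sum_univ_three]

theorem neg_J_mulVec_mem_cell {r : ℝ} {s : Block} {w : Vec} (hw : w ∈ cell r s) :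
    -(J *ᵥ w) ∈ cell r (mirror s) := by
  rw [J_mulVec]
  cases s <;> simp [cell, mirror] at hw ⊢ <;> tauto

theorem word_add_three (n : ℕ) : word (n + 3) = mirror (word n) := by
  have hpattern : ∀ k : Fin 6, pattern132312 (k + 3) = mirror (pattern132312 k) := by
    intro k
    fin_cases k <;> rfl
  have hcast : (Fin.ofNat 6 (n + 3) : Fin 6) = Fin.ofNat 6 n + 3 := by
    ext
    simp [Fin.ofNat, Fin.val_add]
  rw [word, word, hcast, hpattern]

theorem J_mul_J : J * J = 1 := by
  ext i j
  fin_cases i <;> fin_cases j <;> simp [J, Matrix.mul_apply, Fin.sum_univ_three]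

theorem prefixProd_word_add_three (r : ℝ) (n : ℕ) :
    prefixProd r word (n + 3) = J * prefixProd r word n * reducedMatrix r := by
  induction n with
  | zero =>
    change P2 r * (P3 r * (P1 r * 1)) = J * 1 * (J * P2 r * P3 r * P1 r)
    simp only [← mul_assoc, mul_one, J_mul_J, one_mul]
  | succ n ih =>
    rw [Nat.succ_add, prefixProd, ih, word_add_three, prefixProd, ← mul_assoc, ← mul_assoc,
      mirror_matrix_mul_J, mul_assoc J]

theorem prefixProd_word_three (r : ℝ) : prefixProd r word 3 = J * reducedMatrix r := by
  simpa only [zero_add, prefixProd, mul_one] using prefixProd_word_add_three r 0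

theorem prefixProd_word_six (r : ℝ) : prefixProd r word 6 = reducedMatrix r ^ 2 := by
  rw [prefixProd_word_add_three r 3, prefixProd_word_three, ← mul_assoc, J_mul_J, one_mul, sq]

theorem prefixProd_word_mulVec_mem_cell {r l : ℝ} (hl : 0 < l) {u : Vec}
    (hu : reducedMatrix r *ᵥ u = (-l) • u) (h0 : u ∈ cell r .one)
    (h1 : P1 r *ᵥ u ∈ cell r .three) (h2 : P3 r *ᵥ (P1 r *ᵥ u) ∈ cell r .two) (n : ℕ) :
    prefixProd r word n *ᵥ u ∈ cell r (word n) := by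
  induction n using Nat.strong_induction_on with
  | _ n ih =>
    match n with
    | 0 => exact (prefixProd_zero_mulVec r word u).symm ▸ h0
    | 1 =>
      rw [prefixProd_succ_mulVec, prefixProd_zero_mulVec]
      exact h1
    | 2 =>
      rw [prefixProd_succ_mulVec, prefixProd_succ_mulVec, prefixProd_zero_mulVec]
      exact h2
    | n + 3 =>
      rw [word_add_three, prefixProd_word_add_three, ← Matrix.mulVec_mulVec, hu,
        Matrix.mulVec_smul, ← Matrix.mulVec_mulVec, neg_smul, ← smul_neg, smul_mem_cell_iff hl]
      exact neg_J_mulVec_mem_cell (ih n (by lia))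

theorem P1_mulVec_mem_cell_three {r : ℝ} (hr : 0 < r) {u : Vec} (hu : u ∈ cell r .one)
    (hz : (P3 r *ᵥ (P1 r *ᵥ u)) 2 < 0) : P1 r *ᵥ u ∈ cell r .three := by
  obtain ⟨⟨-, hu2⟩, -, hexcess⟩ := hu
  have hx : 0 < (P1 r *ᵥ u) 0 := by
    rw [P1_mulVec_eq]
    exact mul_pos hr hexcess
  have hz1 : (P1 r *ᵥ u) 2 < 0 := by
    rw [P1_mulVec_eq]
    exact mul_neg_of_pos_of_neg (by positivity) hu2
  have hyz : alpha r * (P1 r *ᵥ u) 1 - (P1 r *ᵥ u) 2 < 0 := by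
    rw [P3_mulVec_eq] at hz
    exact neg_of_mul_neg_right hz hr.le
  exact ⟨⟨hx, hz1⟩, neg_of_mul_neg_right (by linarith) (alpha_pos hr).le, hyz⟩

end Word

namespace IsLargestRoot

variable {r l : ℝ} {u v : Vec}

theorem depth_pos (h : IsLargestRoot r l) (hr0 : 0 < r) (hr1 : r < 1) (hm : 0 ≤ margin r l)
    (hu : reducedMatrix r *ᵥ u = (-l) • u) (h0 : 0 < u 0) : 0 < depth r u := by
  have hcoef : 0 < r * eigenDet r l := mul_pos hr0 (h.eigenDet_pos hr0 hr1 hm)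
  refine pos_of_mul_pos_right ?_ hcoef.le
  rw [eigenDet_mul_depth hr0.ne' hu, alpha_sq_sub]
  have hl := h.pos hr0 hr1
  have hsq := h.sq_sub_pow_pos hr0 hr1
  have : 0 < 1 - r := sub_pos.2 hr1
  positivity

theorem excess_pos (h : IsLargestRoot r l) (hr0 : 0 < r) (hr1 : r < 1) (hm : 0 < margin r l)
    (hu : reducedMatrix r *ᵥ u = (-l) • u) (h0 : 0 < u 0) : 0 < excess r u := by
  refine pos_of_mul_pos_right ?_ (h.sq_sub_pow_pos hr0 hr1).le
  rw [excess_eq_depth_mul_margin hr0.ne' hu]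
  exact mul_pos (mul_pos (alpha_pos hr0) (h.depth_pos hr0 hr1 hm.le hu h0)) hm

theorem mem_cell_one (h : IsLargestRoot r l) (hr0 : 0 < r) (hr1 : r < 1) (hm : 0 < margin r l)
    (hu : reducedMatrix r *ᵥ u = (-l) • u) (h0 : 0 < u 0) : u ∈ cell r .one := by
  have hα := alpha_pos hr0
  have hdepth := h.depth_pos hr0 hr1 hm.le hu h0
  have hexcess : 0 < alpha r * u 1 - u 0 := h.excess_pos hr0 hr1 hm hu h0
  have hz : u 2 < 0 := by
    refine neg_of_mul_neg_right ?_ (h.pos hr0 hr1).le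
    rw [mul_coord_two_of_eigenvector hu, excess, neg_lt_zero]
    positivity
  exact ⟨⟨h0, hz⟩, pos_of_mul_pos_right (h0.trans (sub_pos.1 hexcess)) hα.le, hexcess⟩

theorem P3_mulVec_P1_mulVec_mem_cell_two (h : IsLargestRoot r l) (hr0 : 0 < r) (hr1 : r < 1)
    (hm : 0 < margin r l) (hu : reducedMatrix r *ᵥ u = (-l) • u) (h0 : 0 < u 0) :
    P3 r *ᵥ (P1 r *ᵥ u) ∈ cell r .two := by
  have hα := alpha_pos hr0
  have hdepth := h.depth_pos hr0 hr1 hm.le hu h0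
  have hx : 0 < (P3 r *ᵥ (P1 r *ᵥ u)) 0 := by
    rw [P3_mulVec_P1_mulVec_zero]
    exact mul_pos (pow_pos hr0 3) (h.excess_pos hr0 hr1 hm hu h0)
  have hy : (P3 r *ᵥ (P1 r *ᵥ u)) 1 < 0 := neg_pos.1 hdepth
  have hz : r * (P3 r *ᵥ (P1 r *ᵥ u)) 2 < -(r * alpha r * depth r u) := by
    rw [mul_P3_mulVec_P1_mulVec_two_of_eigenvector hu]
    exact sub_lt_self _ (mul_pos (h.pos hr0 hr1) h0)
  have hyz : 0 < alpha r * (P3 r *ᵥ (P1 r *ᵥ u)) 1 - (P3 r *ᵥ (P1 r *ᵥ u)) 2 := by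
    refine pos_of_mul_pos_right (a := r) ?_ hr0.le
    rw [depth] at hz
    linarith
  exact ⟨⟨hx, by nlinarith⟩, hy.ne, by nlinarith, hyz⟩

theorem prefixProd_mulVec_mem_cell (h : IsLargestRoot r l) (hr0 : 0 < r) (hr1 : r < 1)
    (hm : 0 < margin r l) (hu : reducedMatrix r *ᵥ u = (-l) • u) (h0 : 0 < u 0) (n : ℕ) :
    prefixProd r word n *ᵥ u ∈ cell r (word n) := by
  have hone := h.mem_cell_one hr0 hr1 hm hu h0
  have htwo := h.P3_mulVec_P1_mulVec_mem_cell_two hr0 hr1 hm hu h0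
  exact prefixProd_word_mulVec_mem_cell (h.pos hr0 hr1) hu hone
    (P1_mulVec_mem_cell_three hr0 hone (pos_of_mem_cell htwo).2) htwo n

theorem generatesPattern (h : IsLargestRoot r l) (hr0 : 0 < r) (hr1 : r < 1)
    (hm : 0 < margin r l) (hu : reducedMatrix r *ᵥ u = (-l) • u) (h0 : 0 < u 0) :
    GeneratesPattern r pattern132312 (toSphere u) := by
  have hcell := h.prefixProd_mulVec_mem_cell hr0 hr1 hm hu h0
  have hsector := fun k => cell_subset_sector r (word k) (hcell k)
  have hu0 := hcell 0
  rw [prefixProd_zero_mulVec] at hu0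
  refine ⟨toSphere_mem_domX (cell_subset_sector r _ hu0).1 (ne_zero_of_mem_cell hu0),
    fun k => ?_, ?_⟩
  · rw [iterate_bMap_toSphere fun k _ => hsector k, code_toSphere,
      code_of_mem_quadrant r (hsector k).1, (hsector k).2, word_fin]
  · rw [iterate_bMap_toSphere fun k _ => hsector k, prefixProd_word_six, sq,
      ← Matrix.mulVec_mulVec, hu, Matrix.mulVec_smul, hu, smul_smul, neg_mul_neg,
      toSphere_smul (mul_pos (h.pos hr0 hr1) (h.pos hr0 hr1))]

end IsLargestRoot

theorem GeneratesPattern.iterate_mem_domX {r : ℝ} (hr : 0 < r) {n : ℕ} {s : Fin n → Block}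
    {v : Vec} (h : GeneratesPattern r s v) (k : ℕ) : (bMap r)^[k] v ∈ domX :=
  ((mapsTo_bMap hr).mono_right inter_subset_left).iterate k h.1

theorem collisionsFollow_of_mem_cell {r : ℝ} (hr : 0 < r) {w : ℕ → Block} {n : ℕ}
    {s : Fin n → Block} (hw : ∀ k : Fin n, w k = s k) {u : Vec}
    (h : GeneratesPattern r s (toSphere u))
    (hcell : ∀ k, prefixProd r w k *ᵥ u ∈ cell r (w k)) :
    CollisionsFollow r s (toSphere u) := by
  intro k
  have hk := h.iterate_mem_domX hr k
  rw [iterate_bMap_toSphere fun k _ => cell_subset_sector r _ (hcell k)] at hk ⊢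
  rw [← hw]
  exact exists_bToB_eq_of_mem_cell hr (toSphere_mem_cell_iff.2 (hcell k)) hk

section Uniqueness

theorem pos_of_mem_sector_one {r : ℝ} {w : Vec} (hw : w ∈ sector r .one) : 0 < w 1 := by
  have h := hw.2
  unfold letter at h
  split_ifs at h with h1
  exact h1.1

theorem neg_of_mem_sector_three {r : ℝ} {w : Vec} (hw : w ∈ sector r .three) : w 1 < 0 := by
  have h := hw.2
  unfold letter at h
  split_ifs at h with h1 h3
  exact h3.1

namespace GeneratesPattern

variable {r : ℝ} {v : Vec} {n : ℕ} {s : Fin n → Block}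

theorem mem_quadrant (h : GeneratesPattern r s v) (hr : 0 < r) (hn : n ≠ 0) : v ∈ quadrant := by
  obtain ⟨m, rfl⟩ := Nat.exists_eq_succ_of_ne_zero hn
  rw [← h.2.2, Function.iterate_succ_apply']
  exact (mapsTo_bMap hr (h.iterate_mem_domX hr m)).2

theorem prefixProd_mulVec_mem_sector (h : GeneratesPattern r s v) (hr : 0 < r) {w : ℕ → Block}
    (hw : ∀ k : Fin n, w k = s k) {k : ℕ} (hk : k < n) :
    prefixProd r w k *ᵥ v ∈ sector r (w k) := by
  induction k using Nat.strong_induction_on with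
  | _ k ih =>
    have hiter := iterate_bMap_toSphere fun j hj => ih j hj (hj.trans hk)
    rw [toSphere_eq_self_of_mem_domX h.1] at hiter
    have hq : (bMap r)^[k] v ∈ quadrant := by
      cases k with
      | zero => exact h.mem_quadrant hr hk.ne'
      | succ k =>
        rw [Function.iterate_succ_apply']
        exact (mapsTo_bMap hr (h.iterate_mem_domX hr k)).2
    have hcode : letter r ((bMap r)^[k] v) = w k := by
      rw [← code_of_mem_quadrant r hq, hw ⟨k, hk⟩]
      exact h.2.1 ⟨k, hk⟩
    rw [← toSphere_mem_sector_iff, ← hiter]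
    exact ⟨hq, hcode⟩

theorem toSphere_prefixProd_mulVec (h : GeneratesPattern r s v) (hr : 0 < r) {w : ℕ → Block}
    (hw : ∀ k : Fin n, w k = s k) : toSphere (prefixProd r w n *ᵥ v) = v := by
  rw [← iterate_bMap_toSphere fun k hk => h.prefixProd_mulVec_mem_sector hr hw hk,
    toSphere_eq_self_of_mem_domX h.1, h.2.2]

theorem exists_reducedMatrix_mulVec_mulVec (h : GeneratesPattern r pattern132312 v)
    (hr : 0 < r) : ∃ m : ℝ, 0 < m ∧ reducedMatrix r *ᵥ (reducedMatrix r *ᵥ v) = m ^ 2 • v := by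
  have hv := h.toSphere_prefixProd_mulVec hr word_fin
  rw [prefixProd_word_six, sq, ← Matrix.mulVec_mulVec] at hv
  obtain ⟨c, hc, hcv⟩ := exists_pos_toSphere_eq_smul (reducedMatrix r *ᵥ (reducedMatrix r *ᵥ v))
  refine ⟨√c⁻¹, by positivity, ?_⟩
  rw [Real.sq_sqrt (by positivity), eq_inv_smul_iff₀ hc.ne', ← hcv, hv]

/-- For such an eigenvector the quadrant would contain both `v` and the image `m • J *ᵥ v` of `v`
after three steps, so `x = z = 0`; this contradicts the signs of the first two `y`-coordinates. -/
theorem reducedMatrix_mulVec_ne_smul (h : GeneratesPattern r pattern132312 v) (hr : 0 < r)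
    {m : ℝ} (hm : 0 < m) : reducedMatrix r *ᵥ v ≠ m • v := by
  intro heig
  have hone := h.prefixProd_mulVec_mem_sector hr word_fin (k := 0) (by norm_num)
  have hthree := h.prefixProd_mulVec_mem_sector hr word_fin (k := 1) (by norm_num)
  have hlast := h.prefixProd_mulVec_mem_sector hr word_fin (k := 3) (by norm_num)
  rw [prefixProd_succ_mulVec, prefixProd_zero_mulVec] at hthree
  rw [prefixProd_zero_mulVec] at hone
  rw [prefixProd_word_three, ← Matrix.mulVec_mulVec, heig, Matrix.mulVec_smul, J_mulVec] at hlast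
  obtain ⟨hz, hx⟩ := (smul_mem_quadrant_iff hm).1 hlast.1
  have hx0 : v 0 = 0 := le_antisymm hx hone.1.1
  have hz0 : v 2 = 0 := le_antisymm hone.1.2 hz
  have hy : 0 < v 1 := pos_of_mem_sector_one hone
  have hy' : (P1 r *ᵥ v) 1 < 0 := neg_of_mem_sector_three hthree
  have hP1 : (P1 r *ᵥ v) 1 = (1 - r) ^ 2 / 4 * v 1 := by
    rw [P1_mulVec_eq, ← alpha_sq_sub]
    simp only [hx0, hz0, Matrix.cons_val]
    ring
  rw [hP1] at hy'
  exact hy'.not_ge (by positivity)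

theorem reducedMatrix_mulVec (h : GeneratesPattern r pattern132312 v) {l : ℝ}
    (hl : IsLargestRoot r l) (hr : 11 / 50 < r) (hr1 : r < 1) :
    reducedMatrix r *ᵥ v = (-l) • v := by
  have hr0 : 0 < r := by linarith
  obtain ⟨m, hm, hmv⟩ := h.exists_reducedMatrix_mulVec_mulVec hr0
  have heig : reducedMatrix r *ᵥ (reducedMatrix r *ᵥ v - m • v) =
      (-m) • (reducedMatrix r *ᵥ v - m • v) := by
    rw [Matrix.mulVec_sub, Matrix.mulVec_smul, hmv]
    module
  have hne := sub_ne_zero.2 (h.reducedMatrix_mulVec_ne_smul hr0 hm)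
  have hml : m = l := hl.eq_of_pos hr hr1 hm
    (isRoot_charpoly_reducedMatrix_neg.1 (isRoot_charpoly_iff.2 ⟨_, hne, heig⟩))
  refine (hl.isDominatingEigenvalue hr0 hr1).mulVec_eq_smul (neg_ne_zero.2 ?_) ?_
  · exact (hl.pos hr0 hr1).ne'
  · rw [neg_sq, ← hml, hmv]

theorem eq_toSphere (h : GeneratesPattern r pattern132312 v) {l : ℝ} (hl : IsLargestRoot r l)
    (hr : 11 / 50 < r) (hr1 : r < 1) (hm : 0 ≤ margin r l) {u : Vec}
    (hu : reducedMatrix r *ᵥ u = (-l) • u) (h0 : u 0 = 1) : v = toSphere u := by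
  have hr0 : 0 < r := by linarith
  have hvu := hl.eigenvector_eq hr0 hr1 hm hu h0 (h.reducedMatrix_mulVec hl hr hr1)
  have hx : 0 ≤ v 0 := (h.mem_quadrant hr0 (by norm_num)).1
  have hx0 : v 0 ≠ 0 := fun hx0 => by
    rw [hx0, zero_smul] at hvu
    simpa [hvu] using h.1.1
  rw [← toSphere_eq_self_of_mem_domX h.1, hvu, toSphere_smul (hx.lt_of_ne' hx0)]

end GeneratesPattern

end Uniqueness

section StableOrbit

variable {E : Type*} [PseudoMetricSpace E] {f g : E → E} {u : E}

/-- Local asymptotic stability of the orbit of `u` under `f`, as in `IsLocallyStableOrbit`, for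
starting points in a full neighborhood of `u` and for the distance of an arbitrary space. -/
def IsStableOrbit (f : E → E) (u : E) : Prop :=
  (∀ ε > 0, ∀ᶠ v in 𝓝 u, ∀ n, dist (f^[n] v) (f^[n] u) < ε) ∧
    ∀ᶠ v in 𝓝 u, Tendsto (fun n => dist (f^[n] v) (f^[n] u)) atTop (𝓝 0)

namespace IsStableOrbit

theorem eventually_forall_iterate (h : IsStableOrbit f u) (hu : Function.IsFixedPt f u)
    {p : E → Prop} (hp : ∀ᶠ v in 𝓝 u, p v) : ∀ᶠ v in 𝓝 u, ∀ n, p (f^[n] v) := by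
  obtain ⟨ε, hε, hball⟩ := Metric.eventually_nhds_iff.1 hp
  filter_upwards [h.1 ε hε] with v hv n
  refine hball ?_
  simpa only [(hu.iterate n).eq] using hv n

theorem congr (h : IsStableOrbit f u) (hu : Function.IsFixedPt f u) (hfg : f =ᶠ[𝓝 u] g) :
    IsStableOrbit g u := by
  have hiter : ∀ᶠ v in 𝓝 u, ∀ n, f^[n] v = g^[n] v := by
    filter_upwards [h.eventually_forall_iterate hu hfg] with v hv n
    induction n with
    | zero => rfl
    | succ n ih => rw [Function.iterate_succ_apply', Function.iterate_succ_apply', hv, ih]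
  have hiter_u := hiter.self_of_nhds
  refine ⟨fun ε hε => ?_, ?_⟩
  · filter_upwards [h.1 ε hε, hiter] with v hv hvg n
    rw [← hvg, ← hiter_u]
    exact hv n
  · filter_upwards [h.2, hiter] with v hv hvg
    simpa only [hvg, hiter_u] using hv

theorem of_iterate {p : ℕ} (hp : 0 < p) (hu : Function.IsPeriodicPt f p u)
    (hc : ∀ k < p, ContinuousAt f^[k] u) (h : IsStableOrbit f^[p] u) : IsStableOrbit f u := by
  have hdist (v : E) (n : ℕ) : dist (f^[n] v) (f^[n] u) =
      dist (f^[n % p] ((f^[p])^[n / p] v)) (f^[n % p] u) := by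
    rw [hu.iterate_mod_apply, ← Function.iterate_mul, ← Function.iterate_add_apply,
      Nat.mod_add_div]
  have hnear (ε : ℝ) (hε : 0 < ε) :
      ∀ᶠ v in 𝓝 u, ∀ k < p, dist (f^[k] v) (f^[k] u) < ε :=
    (Set.finite_lt_nat p).eventually_all.2 fun k hk =>
      (hc k hk).eventually (Metric.ball_mem_nhds _ hε)
  refine ⟨fun ε hε => ?_, ?_⟩
  · filter_upwards [h.eventually_forall_iterate hu (hnear ε hε)] with v hv n
    rw [hdist]
    exact hv _ _ (Nat.mod_lt n hp)
  · filter_upwards [h.2] with v hv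
    have hfixed (n : ℕ) : (f^[p])^[n] u = u := Function.IsFixedPt.iterate hu n
    simp only [hfixed, ← tendsto_iff_dist_tendsto_zero] at hv
    refine Metric.tendsto_nhds.2 fun ε hε => ?_
    filter_upwards [(Nat.tendsto_div_const_atTop hp.ne').eventually
      (hv.eventually (hnear ε hε))] with n hn
    rw [hdist, Real.dist_0_eq_abs, abs_of_nonneg dist_nonneg]
    exact hn _ (Nat.mod_lt n hp)

theorem isLocallyStableOrbit {f : Vec → Vec} {u : Vec} (h : IsStableOrbit f u) (X : Set Vec) :
    IsLocallyStableOrbit f X u := by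
  have hball {p : Vec → Prop} (hp : ∀ᶠ v in 𝓝 u, p v) :
      ∃ δ > 0, ∀ v ∈ X, norm2 (v - u) < δ → p v := by
    obtain ⟨δ, hδ, hδp⟩ := Metric.eventually_nhds_iff.1 hp
    refine ⟨δ, hδ, fun v _ hv => hδp ?_⟩
    rw [dist_eq_norm]
    exact (norm_le_norm2 _).trans_lt hv
  have hnorm2 : Tendsto norm2 (𝓝 0) (𝓝 0) := by
    have h0 : norm2 0 = 0 := by simp [norm2]
    exact h0 ▸ continuous_norm2.tendsto 0
  refine ⟨fun ε hε => ?_, ?_⟩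
  · obtain ⟨η, hη, hηε⟩ := Metric.eventually_nhds_iff.1 (hnorm2.eventually_lt_const hε)
    obtain ⟨δ, hδ, hstable⟩ := hball (h.1 η hη)
    refine ⟨δ, hδ, fun v hv hvu n => hηε ?_⟩
    rw [dist_zero_right, ← dist_eq_norm]
    exact hstable v hv hvu n
  · obtain ⟨δ, hδ, hconv⟩ := hball h.2
    refine ⟨δ, hδ, fun v hv hvu => hnorm2.comp (tendsto_zero_iff_norm_tendsto_zero.2 ?_)⟩
    simpa only [dist_eq_norm] using hconv v hv hvu

end IsStableOrbit

end StableOrbit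

section PowerIteration

variable {T E : Matrix (Fin 3) (Fin 3) ℝ} {a : Vec}

open scoped Matrix.Norms.Operator in
theorem exists_norm_pow_mulVec_le (hT : Tendsto (fun n => T ^ n) atTop (𝓝 E)) :
    ∃ C > 0, ∀ (n : ℕ) (v : Vec), ‖T ^ n *ᵥ v‖ ≤ C * ‖v‖ := by
  obtain ⟨C, hC, hbound⟩ := (Metric.isBounded_range_of_tendsto _ hT).exists_pos_norm_le
  refine ⟨C, hC, fun n v => (Matrix.linfty_opNorm_mulVec _ _).trans ?_⟩
  gcongr
  exact hbound _ (mem_range_self n)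

theorem pow_mulVec_of_fixed (ha : T *ᵥ a = a) (n : ℕ) : T ^ n *ᵥ a = a := by
  induction n with
  | zero => rw [pow_zero, Matrix.one_mulVec]
  | succ n ih => rw [pow_succ, ← Matrix.mulVec_mulVec, ha, ih]

theorem eventually_forall_pow_mulVec (hT : Tendsto (fun n => T ^ n) atTop (𝓝 E))
    (ha : T *ᵥ a = a) {p : Vec → Prop} (hp : ∀ᶠ v in 𝓝 a, p v) :
    ∀ᶠ v in 𝓝 a, ∀ n, p (T ^ n *ᵥ v) := by
  obtain ⟨C, hC, hbound⟩ := exists_norm_pow_mulVec_le hT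
  obtain ⟨ε, hε, hball⟩ := Metric.eventually_nhds_iff.1 hp
  filter_upwards [Metric.ball_mem_nhds a (div_pos hε hC)] with v hv n
  refine hball ?_
  calc dist (T ^ n *ᵥ v) a = ‖T ^ n *ᵥ (v - a)‖ := by
        rw [Matrix.mulVec_sub, pow_mulVec_of_fixed ha, dist_eq_norm]
    _ ≤ C * dist v a := by
        rw [dist_eq_norm]
        exact hbound n _
    _ < ε := (lt_div_iff₀' hC).1 hv

theorem iterate_succ_toSphere_mulVec (T : Matrix (Fin 3) (Fin 3) ℝ) (n : ℕ) (v : Vec) :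
    (fun w => toSphere (T *ᵥ w))^[n + 1] v = toSphere (T ^ (n + 1) *ᵥ v) := by
  induction n with
  | zero => rw [zero_add, Function.iterate_one, pow_one]
  | succ n ih =>
    rw [Function.iterate_succ_apply', ih, toSphere_mulVec_toSphere, Matrix.mulVec_mulVec,
      ← pow_succ']

theorem eventually_exists_pos_mulVec_eq_smul (ha : E *ᵥ a = a) (ha0 : a ≠ 0)
    (hE : ∀ v, ∃ c : ℝ, E *ᵥ v = c • a) : ∀ᶠ v in 𝓝 a, ∃ c : ℝ, 0 < c ∧ E *ᵥ v = c • a := by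
  have hpos : 0 < a ⬝ᵥ a := Matrix.dotProduct_star_self_pos_iff.2 ha0
  have hcont : Continuous fun v => a ⬝ᵥ (E *ᵥ v) := by fun_prop
  have hnear : ∀ᶠ v in 𝓝 a, 0 < a ⬝ᵥ (E *ᵥ v) :=
    hcont.continuousAt.eventually_const_lt (by simpa only [ha] using hpos)
  filter_upwards [hnear] with v hv
  obtain ⟨c, hc⟩ := hE v
  rw [hc, dotProduct_smul, smul_eq_mul] at hv
  exact ⟨c, pos_of_mul_pos_left hv hpos.le, hc⟩

theorem isStableOrbit_toSphere_mulVec (hT : Tendsto (fun n => T ^ n) atTop (𝓝 E))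
    (ha : T *ᵥ a = a) (ha0 : a ≠ 0) (hsphere : toSphere a = a)
    (hE : ∀ v, ∃ c : ℝ, E *ᵥ v = c • a) : IsStableOrbit (fun v => toSphere (T *ᵥ v)) a := by
  have hfixed (n : ℕ) : (fun v => toSphere (T *ᵥ v))^[n] a = a :=
    Function.IsFixedPt.iterate (by rw [Function.IsFixedPt, ha, hsphere]) n
  have hlim (v : Vec) : Tendsto (fun n => T ^ n *ᵥ v) atTop (𝓝 (E *ᵥ v)) :=
    ((continuous_id.matrix_mulVec continuous_const).tendsto E).comp hT
  have hEa : E *ᵥ a = a := by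
    refine tendsto_nhds_unique (hlim a) ?_
    simp only [pow_mulVec_of_fixed ha, tendsto_const_nhds_iff]
  simp only [IsStableOrbit, hfixed]
  refine ⟨fun ε hε => ?_, ?_⟩
  · have hcont := (continuousAt_toSphere ha0).eventually (Metric.ball_mem_nhds _ hε)
    rw [hsphere] at hcont
    filter_upwards [Metric.ball_mem_nhds a hε, eventually_forall_pow_mulVec hT ha hcont]
      with v hv hpow n
    cases n with
    | zero => exact hv
    | succ n =>
      rw [iterate_succ_toSphere_mulVec]
      exact hpow (n + 1)
  · filter_upwards [eventually_exists_pos_mulVec_eq_smul hEa ha0 hE] with v hv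
    obtain ⟨c, hc, hcv⟩ := hv
    have hne : E *ᵥ v ≠ 0 := by
      rw [hcv]
      exact smul_ne_zero hc.ne' ha0
    have htendsto := (continuousAt_toSphere hne).tendsto.comp (hlim v)
    rw [hcv, toSphere_smul hc, hsphere] at htendsto
    rw [← tendsto_iff_dist_tendsto_zero, ← tendsto_add_atTop_iff_nat 1]
    simpa only [iterate_succ_toSphere_mulVec, Function.comp_def] using
      (tendsto_add_atTop_iff_nat 1).2 htendsto

end PowerIteration

theorem iterate_succ_bMap_eventuallyEq {r : ℝ} {s : ℕ → Block} {a : Vec} (n : ℕ)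
    (ha : ∀ k ≤ n, prefixProd r s k *ᵥ a ∈ cell r (s k)) :
    (bMap r)^[n + 1] =ᶠ[𝓝 a] fun v => toSphere (prefixProd r s (n + 1) *ᵥ v) := by
  have hcell : ∀ᶠ v in 𝓝 a, ∀ k ≤ n, prefixProd r s k *ᵥ v ∈ cell r (s k) :=
    (Set.finite_le_nat n).eventually_all.2 fun k hk =>
      (continuous_const.matrix_mulVec continuous_id).continuousAt.eventually
        ((isOpen_cell r (s k)).mem_nhds (ha k hk))
  filter_upwards [hcell] with v hv
  rw [← iterate_succ_bMap_toSphere, iterate_bMap_toSphere fun k hk =>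
    cell_subset_sector r _ (hv k (Nat.lt_succ_iff.1 hk))]

theorem continuousAt_iterate_bMap {r : ℝ} {s : ℕ → Block} {a : Vec}
    (ha : ∀ k, prefixProd r s k *ᵥ a ∈ cell r (s k)) (n : ℕ) :
    ContinuousAt (bMap r)^[n] a := by
  cases n with
  | zero => exact continuousAt_id
  | succ n =>
    refine ContinuousAt.congr ?_ (iterate_succ_bMap_eventuallyEq n fun k _ => ha k).symm
    exact ContinuousAt.comp (f := fun v => prefixProd r s (n + 1) *ᵥ v)
      (continuousAt_toSphere (ne_zero_of_mem_cell (ha (n + 1))))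
      (continuous_const.matrix_mulVec continuous_id).continuousAt

theorem isStableOrbit_bMap {r : ℝ} {s : ℕ → Block} {a : Vec} {p : ℕ} (hp : 0 < p)
    (hcell : ∀ k, prefixProd r s k *ᵥ a ∈ cell r (s k))
    (hfixed : toSphere (prefixProd r s p *ᵥ a) = a)
    (h : IsStableOrbit (fun v => toSphere (prefixProd r s p *ᵥ v)) a) :
    IsStableOrbit (bMap r) a := by
  obtain ⟨n, rfl⟩ := Nat.exists_eq_succ_of_ne_zero hp.ne'
  have heq := iterate_succ_bMap_eventuallyEq n fun k _ => hcell k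
  exact .of_iterate hp (heq.self_of_nhds.trans hfixed)
    (fun k _ => continuousAt_iterate_bMap hcell k) (h.congr hfixed heq.symm)

theorem IsLargestRoot.isStableOrbit {r l : ℝ} (h : IsLargestRoot r l) (hr0 : 0 < r) (hr1 : r < 1)
    (hm : 0 < margin r l) {u : Vec} (hu : reducedMatrix r *ᵥ u = (-l) • u) (h0 : u 0 = 1) :
    IsStableOrbit (bMap r) (toSphere u) := by
  have hl : -l ≠ 0 := neg_ne_zero.2 (h.pos hr0 hr1).ne'
  obtain ⟨c, hc, hcu⟩ := exists_pos_toSphere_eq_smul u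
  have hcell (k : ℕ) : prefixProd r word k *ᵥ toSphere u ∈ cell r (word k) := by
    rw [hcu, Matrix.mulVec_smul, smul_mem_cell_iff hc]
    exact h.prefixProd_mulVec_mem_cell hr0 hr1 hm hu (h0 ▸ one_pos) k
  have ha0 : toSphere u ≠ 0 := ne_zero_of_mem_cell (prefixProd_zero_mulVec r word _ ▸ hcell 0)
  have hfixed : ((-l)⁻¹ • reducedMatrix r) ^ 2 *ᵥ toSphere u = toSphere u := by
    refine pow_mulVec_of_fixed ?_ 2
    rw [hcu, Matrix.smul_mulVec, Matrix.mulVec_smul, hu, smul_comm c, inv_smul_smul₀ hl]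
  obtain ⟨E, hE, hME⟩ := (h.isDominatingEigenvalue hr0 hr1).exists_tendsto_pow hl
  have hspan (v : Vec) : ∃ b : ℝ, E *ᵥ v = b • toSphere u := by
    refine ⟨(E *ᵥ v) 0 * c⁻¹, ?_⟩
    rw [hcu, mul_smul, inv_smul_smul₀ hc.ne']
    refine h.eigenvector_eq hr0 hr1 hm.le hu h0 ?_
    rw [Matrix.mulVec_mulVec, hME, Matrix.smul_mulVec]
  have hsq : Tendsto (fun n => (((-l)⁻¹ • reducedMatrix r) ^ 2) ^ n) atTop (𝓝 E) := by
    simp only [← pow_mul]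
    exact hE.comp (tendsto_id.const_mul_atTop' two_pos)
  have hperiod (v : Vec) : toSphere (prefixProd r word 6 *ᵥ v) =
      toSphere (((-l)⁻¹ • reducedMatrix r) ^ 2 *ᵥ v) := by
    rw [prefixProd_word_six, smul_pow, Matrix.smul_mulVec, toSphere_smul (by positivity)]
  refine isStableOrbit_bMap (p := 6) (by norm_num) hcell ?_ ?_
  · rw [hperiod, hfixed, toSphere_toSphere]
  · simp only [hperiod]
    exact isStableOrbit_toSphere_mulVec hsq hfixed ha0 (toSphere_toSphere u) hspan

theorem existsUnique_isDominatingEigenvalue {r : ℝ} (hr0 : 0 < r) (hr1 : r < 1) :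
    ∃! l : ℝ, IsDominatingEigenvalue (reducedMatrix r) l := by
  obtain ⟨l, hl⟩ := exists_isLargestRoot hr0 hr1
  have hdom := hl.isDominatingEigenvalue hr0 hr1
  exact ⟨-l, hdom, fun m hm => hdom.unique hm⟩

theorem exists_dominatingEigenvector_generating_stable_orbit {r : ℝ} (hr : 11 / 50 < r)
    (hr1 : r < 1) (hc : critPoly r < 0) : ∃ u : Vec,
      (∀ u' : Vec, IsDominatingEigenvector (reducedMatrix r) u' ↔ u' = u) ∧
      (∀ v : Vec, GeneratesPattern r pattern132312 v ↔ v = toSphere u) ∧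
      CollisionsFollow r pattern132312 (toSphere u) ∧
      IsLocallyStableOrbit (bMap r) domX (toSphere u) := by
  have hr0 : 0 < r := by linarith
  obtain ⟨l, hl⟩ := exists_isLargestRoot hr0 hr1
  have hm := hl.margin_pos hr hr1 hc
  obtain ⟨u, hu, h0⟩ := hl.exists_eigenvector hr0 hr1 hm.le
  have hpos : 0 < u 0 := h0 ▸ one_pos
  have hgen := hl.generatesPattern hr0 hr1 hm hu hpos
  refine ⟨u, fun u' => ?_, fun v => ?_, ?_, ?_⟩
  · rw [hl.isDominatingEigenvector_iff hr0 hr1]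
    refine ⟨fun ⟨hu', h0'⟩ => ?_, fun h => h ▸ ⟨hu, h0⟩⟩
    rw [hl.eigenvector_eq hr0 hr1 hm.le hu h0 hu', h0', one_smul]
  · exact ⟨fun hv => hv.eq_toSphere hl hr hr1 hm.le hu h0, fun hv => hv ▸ hgen⟩
  · exact collisionsFollow_of_mem_cell hr0 word_fin hgen
      (hl.prefixProd_mulVec_mem_cell hr0 hr1 hm hu hpos)
  · exact (hl.isStableOrbit hr0 hr1 hm hu h0).isLocallyStableOrbit domX

end FourSpheres

theorem mainTheorem1 :
    (∀ r ∈ Ioo (0 : ℝ) 1, ∃! l : ℝ, IsDominatingEigenvalue (reducedMatrix r) l) ∧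
    ∃ rc ∈ Ioo (0 : ℝ) 1,
      (∀ r ∈ Ioo (0 : ℝ) 1,
        (∃ u : Vec, IsDominatingEigenvector (reducedMatrix r) u ∧ alpha r * u 1 - u 0 = 0) ↔
          r = rc) ∧
      |rc - 0.22006978614631047521| < 10 ^ (-20 : ℤ) ∧
      3 - 2 * √2 < rc ∧ 0.1918 < rc ∧
      ∀ r ∈ Ioo rc 1, ∃ u : Vec,
        (∀ u' : Vec, IsDominatingEigenvector (reducedMatrix r) u' ↔ u' = u) ∧
        (∀ v : Vec, GeneratesPattern r pattern132312 v ↔ v = toSphere u) ∧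
        CollisionsFollow r pattern132312 (toSphere u) ∧
        IsLocallyStableOrbit (bMap r) domX (toSphere u) := by
  refine ⟨fun r hr => existsUnique_isDominatingEigenvalue hr.1 hr.2, ?_⟩
  obtain ⟨rc, ⟨hlo, hhi⟩, hrc⟩ := exists_critPoly_eq_zero
  have hrc0 : 11 / 50 < rc := by norm_num at hlo ⊢; linarith
  have hrc1 : rc < 1 := by norm_num at hhi ⊢; linarith
  have hanti := strictAntiOn_critPoly
  refine ⟨rc, ⟨by linarith, hrc1⟩, fun r hr => ?_, ?_, ?_, by norm_num; linarith, fun r hr => ?_⟩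
  · refine (exists_dominatingEigenvector_excess_eq_zero_iff hr.1 hr.2).trans ?_
    rw [← hrc]
    exact hanti.injOn.eq_iff (Ioo_subset_Icc_self hr) ⟨by linarith, hrc1.le⟩
  · rw [abs_lt]
    norm_num at hlo hhi ⊢
    constructor <;> linarith
  · have hsqrt : 1.4 < √2 := Real.lt_sqrt_of_sq_lt (by norm_num)
    linarith
  · refine exists_dominatingEigenvector_generating_stable_orbit (hrc0.trans hr.1) hr.2 ?_
    rw [← hrc]
    exact hanti ⟨by linarith, hrc1.le⟩ ⟨by linarith [hr.1], hr.2.le⟩ hr.1
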